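/- Let $\mathcal M$ be a finite-dimensional $C^\infty$ manifold (Hausdorff, second countable, without boundary, of pure dimension) and let $2\le k\le\infty$. A \emph{$C^k$ discretization of $T\mathcal M$} is a tuple $(\psi,\alpha^+,\alpha^-)$ with $\psi:U\subseteq\mathbb R^2\times T\mathcal M\to\mathcal M$, $\alpha^+:[0,a_0)\to\mathbb R_{\ge0}$ and $\alpha^-:[0,a_0)\to\mathbb R_{\le0}$ for some $a_0>0$, such that: (a) $U$ is open, $\{0\}\times\{0\}\times T\mathcal M\subseteq U$, and $\psi$ is continuous; (b) $\alpha^+,\alpha^-$ are $C^1$ and $\alpha^+(h)-\alpha^-(h)=h$; (c) $\psi(h,0,v_m)=m$ and $\frac{\partial\psi}{\partial t}(h,0,v_m)=v_m$ whenever $v_m\in T_m\mathcal M$ and $(h,0,v_m)\in U$; (d) the boundary maps $\partial_h^{+}(v_m)=\psi(h,\alpha^{+}(h),v_m)$ and $\partial_h^{-}(v_m)=\psi(h,\alpha^{-}(h),v_m)$ are $C^k$ in $(h,v_m)$ on their natural domains (the sets of $(h,v_m)$ with $h\in[0,a_0)$ at which the right-hand side is defined), and $\frac{d}{dh}\big|_{h=0}\partial_h^{+}(v_m)=\dot\alpha^{+}v_m$,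 $\frac{d}{dh}\big|_{h=0}\partial_h^{-}(v_m)=\dot\alpha^{-}v_m$, where $\dot\alpha^{\pm}=\frac{d\alpha^{\pm}}{dh}(0)$ (derivatives at $h=0$ are one-sided). A \emph{discrete tangent bundle} of a manifold $\mathcal N$ is a tuple $(\mathcal V,\partial^+,\partial^-)$ where $\mathcal V$ is a manifold with $\dim\mathcal V=2\dim\mathcal N$ and $\partial^+,\partial^-:\mathcal V\to\mathcal N$ are ($C^k$) submersions with $\ker T\partial^+\cap\ker T\partial^-=0$ such that for every $n\in\mathcal N$ the fibres $(\partial^+)^{-1}(n)$ and $(\partial^-)^{-1}(n)$ meet in exactly one point. \textbf{Proposition.} Let $(\psi,\alpha^+,\alpha^-)$ be a $C^k$ discretization of $T\mathcal M$ and let $\mathcal M_0\subseteq\mathcal M$ be a relatively compact open set. Then there are $a>0$ and a family of open sets $\mathcal V_h\subseteq T\mathcal M$ such that for all $h\in(0,a)$ the maps $\partial_h^+$ and $\partial_h^-$ are defined on $\mathcal V_h$ with values in $\mathcal M_0$, and 1. $(\mathcal V_h,\partial_h^+,\partial_h^-)$ is a discrete tangent bundle of $\mathcal M_0$; 2. $\partial_h^\pm=(\partial_h^+,\partial_h^-)$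 is a $C^k$ diffeomorphism from $\mathcal V_h$ onto an open subset of $\mathcal M_0\times\mathcal M_0$ containing the diagonal $\Delta(\mathcal M_0\times\mathcal M_0)$. Moreover, for every $v_m\in T_m\mathcal M$ with $m\in\mathcal M_0$ one has $v_m\in\mathcal V_h$ for all sufficiently small $h>0$. -/

import Mathlib

open Set Filter Topology TopologicalSpace
open scoped Manifold ContDiff

section DiscreteTangentBundles

/-- The curve `c`, defined on `s ⊆ ℝ`, is differentiable at the time `t` (one-sidedly if `t` is an
end point of `s`), and its velocity there is the tangent vector `v`. In particular `c t` is the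
base point of `v`. Only used where `s` is a neighbourhood or a one-sided neighbourhood of `t`. -/
def HasVelocityWithinAt {E : Type*} [NormedAddCommGroup E] [NormedSpace ℝ E]
    {M : Type*} [TopologicalSpace M] [ChartedSpace E M]
    (c : ℝ → M) (s : Set ℝ) (t : ℝ) (v : TangentBundle 𝓘(ℝ, E) M) : Prop :=
  MDifferentiableWithinAt 𝓘(ℝ, ℝ) 𝓘(ℝ, E) c s t ∧
    (⟨c t, mfderivWithin 𝓘(ℝ, ℝ) 𝓘(ℝ, E) c s t 1⟩ : TangentBundle 𝓘(ℝ, E) M) = v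

/-- A `C^k` discretization `(ψ, α⁺, α⁻)` of the tangent bundle `TM` of a manifold `M` modelled
on `E`. The partial maps `ψ : U ⊆ ℝ × ℝ × TM → M` and `α^± : [0, a) → ℝ` are total functions
here, of which only the values on `U` and on `[0, a)` are ever used. -/
structure TangentBundleDiscretization (E : Type*) [NormedAddCommGroup E] [NormedSpace ℝ E]
    (M : Type*) [TopologicalSpace M] [ChartedSpace E M] [IsManifold 𝓘(ℝ, E) ∞ M] (k : ℕ∞) where
  one_le : 1 ≤ k
  /-- the domain of `ψ` -/
  U : Set (ℝ × ℝ × TangentBundle 𝓘(ℝ, E) M)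
  /-- the curve segments `t ↦ ψ h t v` -/
  ψ : ℝ → ℝ → TangentBundle 𝓘(ℝ, E) M → M
  /-- the length of the interval of definition of `α⁺` and `α⁻` -/
  a : ℝ
  αplus : ℝ → ℝ
  αminus : ℝ → ℝ
  a_pos : 0 < a
  isOpen_U : IsOpen U
  zero_mem_U : ∀ v : TangentBundle 𝓘(ℝ, E) M, (0, 0, v) ∈ U
  continuousOn_ψ :
    ContinuousOn (fun p : ℝ × ℝ × TangentBundle 𝓘(ℝ, E) M => ψ p.1 p.2.1 p.2.2) U
  αplus_nonneg : ∀ h ∈ Ico 0 a, 0 ≤ αplus h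
  αminus_nonpos : ∀ h ∈ Ico 0 a, αminus h ≤ 0
  contDiffOn_αplus : ContDiffOn ℝ 1 αplus (Ico 0 a)
  contDiffOn_αminus : ContDiffOn ℝ 1 αminus (Ico 0 a)
  αplus_sub_αminus : ∀ h ∈ Ico 0 a, αplus h - αminus h = h
  /-- `ψ(h, 0, v) = m` and `∂ψ/∂t (h, 0, v) = v` for `v ∈ T_m M` -/
  velocity_ψ : ∀ (h : ℝ) (v : TangentBundle 𝓘(ℝ, E) M), (h, 0, v) ∈ U →
    HasVelocityWithinAt (fun t => ψ h t v) univ 0 v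
  /-- the boundary map `(h, v) ↦ ψ(h, α⁺(h), v)` is `C^k` on its domain -/
  contMDiffOn_plus :
    ContMDiffOn (𝓘(ℝ, ℝ).prod 𝓘(ℝ, E).tangent) 𝓘(ℝ, E) k
      (fun p : ℝ × TangentBundle 𝓘(ℝ, E) M => ψ p.1 (αplus p.1) p.2)
      {p | p.1 ∈ Ico 0 a ∧ (p.1, αplus p.1, p.2) ∈ U}
  /-- the boundary map `(h, v) ↦ ψ(h, α⁻(h), v)` is `C^k` on its domain -/
  contMDiffOn_minus :
    ContMDiffOn (𝓘(ℝ, ℝ).prod 𝓘(ℝ, E).tangent) 𝓘(ℝ, E) k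
      (fun p : ℝ × TangentBundle 𝓘(ℝ, E) M => ψ p.1 (αminus p.1) p.2)
      {p | p.1 ∈ Ico 0 a ∧ (p.1, αminus p.1, p.2) ∈ U}
  /-- `d/dh ∂⁺_h(v) = (dα⁺/dh)(0) v` at `h = 0` -/
  velocity_plus : ∀ v : TangentBundle 𝓘(ℝ, E) M,
    HasVelocityWithinAt (fun h => ψ h (αplus h) v) (Ico 0 a) 0
      ⟨v.proj, derivWithin αplus (Ico 0 a) 0 • v.snd⟩
  /-- `d/dh ∂⁻_h(v) = (dα⁻/dh)(0) v` at `h = 0` -/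
  velocity_minus : ∀ v : TangentBundle 𝓘(ℝ, E) M,
    HasVelocityWithinAt (fun h => ψ h (αminus h) v) (Ico 0 a) 0
      ⟨v.proj, derivWithin αminus (Ico 0 a) 0 • v.snd⟩

namespace TangentBundleDiscretization

variable {E : Type*} [NormedAddCommGroup E] [NormedSpace ℝ E]
  {M : Type*} [TopologicalSpace M] [ChartedSpace E M] [IsManifold 𝓘(ℝ, E) ∞ M] {k : ℕ∞}

/-- The boundary map `∂⁺_h`. -/
def bdryPlus (D : TangentBundleDiscretization E M k) (h : ℝ)
    (v : TangentBundle 𝓘(ℝ, E) M) : M :=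
  D.ψ h (D.αplus h) v

/-- The boundary map `∂⁻_h`. -/
def bdryMinus (D : TangentBundleDiscretization E M k) (h : ℝ)
    (v : TangentBundle 𝓘(ℝ, E) M) : M :=
  D.ψ h (D.αminus h) v

/-- The set of tangent vectors at which both `∂⁺_h` and `∂⁻_h` are defined. -/
def bdryDomain (D : TangentBundleDiscretization E M k) (h : ℝ) :
    Set (TangentBundle 𝓘(ℝ, E) M) :=
  {v | h ∈ Ico 0 D.a ∧ (h, D.αplus h, v) ∈ D.U ∧ (h, D.αminus h, v) ∈ D.U}

end TangentBundleDiscretization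

/-- `(V, ∂⁺, ∂⁻)` is a (`C^k`) discrete tangent bundle of the manifold `M`: `V` is a manifold
(Hausdorff and second countable, the rest being in the instances) of dimension `2 dim M`, and
`∂⁺, ∂⁻ : V → M` are submersions such that `ker T∂⁺ ∩ ker T∂⁻ = 0` and such that the fibres
of `∂⁺` and `∂⁻` over each `m` meet in exactly one point. -/
structure IsDiscreteTangentBundle
    {F : Type*} [NormedAddCommGroup F] [NormedSpace ℝ F] [FiniteDimensional ℝ F]
    {G : Type*} [TopologicalSpace G] (J : ModelWithCorners ℝ F G) [J.Boundaryless]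
    {E : Type*} [NormedAddCommGroup E] [NormedSpace ℝ E] [FiniteDimensional ℝ E]
    {H : Type*} [TopologicalSpace H] (I : ModelWithCorners ℝ E H) [I.Boundaryless]
    (k : ℕ∞)
    {V : Type*} [TopologicalSpace V] [ChartedSpace G V] [IsManifold J ∞ V]
    {M : Type*} [TopologicalSpace M] [ChartedSpace H M] [IsManifold I ∞ M]
    (dplus dminus : V → M) : Prop where
  t2Space : T2Space V
  secondCountable : SecondCountableTopology V
  finrank_eq : Module.finrank ℝ F = 2 * Module.finrank ℝ E
  isSubmersion_plus : Manifold.IsSubmersion J I k dplus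
  isSubmersion_minus : Manifold.IsSubmersion J I k dminus
  ker_inf_ker : ∀ v : V, ∀ w : TangentSpace J v,
    mfderiv J I dplus v w = 0 → mfderiv J I dminus v w = 0 → w = 0
  existsUnique_zero : ∀ m : M, ∃! v : V, dplus v = m ∧ dminus v = m

end DiscreteTangentBundles

/-! At `h = 0` both boundary maps collapse to the projection `TM → M`, so `(∂⁺_h, ∂⁻_h)` degenerates
and the inverse function theorem does not apply directly. The remedy is a blow-up: in charts, with
`F` and `H` representing `∂⁺` and `∂⁻`, replace `(F, H)` by `G_h = (F, (F - H) / h)`. Since `dα⁺/dh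
- dα⁻/dh = 1` at `0`, `G_h` tends to the identity as `h → 0⁺`. The `C^2` hypothesis makes `G_h - id`
Lipschitz with constant `1/2` on a ball independent of `h` (`exists_lipschitz_remainder`,
`exists_approximatesLinearOn_rescaledPair`).

Hence `G_h` is injective on that ball, is a local diffeomorphism, and covers a ball of controlled
radius. For `h ≠ 0` the linear automorphism `(x, y) ↦ (x, x - h y)` carries this back to `(∂⁺_h,
∂⁻_h)`; the diagonal corresponds to `y = 0`, so it is reached near the zero section.

These local facts hold eventually along `𝓝[>] 0 ×ˢ 𝓝 v₀`, and compactness makes them uniform on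
compact subsets of `TM` (`eventually_isGoodOn`). The set `V_h` is the union of the interiors of
those members of a compact exhaustion that are good at time `h`, cut down to vectors whose two
boundary points lie in `M₀`. An injective local diffeomorphism to `M₀ × M₀` whose image contains the
diagonal is a discrete tangent bundle. -/

section Analysis

/-! ### Rescaling the boundary maps in a vector space. -/

variable {E : Type*} [NormedAddCommGroup E] [NormedSpace ℝ E]

/-- A `C^2` family of maps `F h : X → Y`, `h ∈ [0, a)`, whose first-order part in `h` at `h = 0` is
the affine family `z ↦ A z + h • B z`, differs from this family by a map with Lipschitz constant
`o(h)` near each point. -/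
theorem exists_lipschitz_remainder {X Y : Type*} [NormedAddCommGroup X] [NormedSpace ℝ X]
    [NormedAddCommGroup Y] [NormedSpace ℝ Y] {F : ℝ × X → Y} {a r : ℝ} (ha : 0 < a) (hr : 0 < r)
    {z₀ : X} (hF : ContDiffOn ℝ 2 F (Ico 0 a ×ˢ Metric.ball z₀ r)) (A B : X →L[ℝ] Y)
    (hA : ∀ z ∈ Metric.ball z₀ r, F (0, z) = A z)
    (hB : ∀ z ∈ Metric.ball z₀ r, HasDerivWithinAt (fun h => F (h, z)) (B z) (Ico 0 a) 0)
    {ε : ℝ} (hε : 0 < ε) :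
    ∃ δ, 0 < δ ∧ δ ≤ a ∧ δ ≤ r ∧ ∀ h ∈ Ico 0 δ, ∀ z ∈ Metric.ball z₀ δ, ∀ z' ∈ Metric.ball z₀ δ,
      ‖F (h, z) - F (h, z') - (A (z - z') + h • B (z - z'))‖ ≤ h * ε * ‖z - z'‖ := by
  set S : Set (ℝ × X) := Ico 0 a ×ˢ Metric.ball z₀ r with hSdef
  have hS : UniqueDiffOn ℝ S := (uniqueDiffOn_Ico 0 a).prod Metric.isOpen_ball.uniqueDiffOn
  have hmem : ∀ z ∈ Metric.ball z₀ r, ((0 : ℝ), z) ∈ S := fun z hz => ⟨⟨le_rfl, ha⟩, hz⟩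
  have hz₀ : z₀ ∈ Metric.ball z₀ r := Metric.mem_ball_self hr
  -- `P = ∂F/∂h` is `C^1` and equals `B` at `h = 0`. So its `z`-derivative is close to `B` near `(0,
  -- z₀)`, which makes `P(s, ·) - B` Lipschitz with constant `ε`; the mean value inequality in `s`
  -- over `[0, h]` then supplies the factor `h`.
  set P : ℝ × X → Y := fun p => fderivWithin ℝ F S p (1, 0) with hP
  have hPC : ContDiffOn ℝ 1 P S :=
    (hF.fderivWithin hS (by norm_num)).clm_apply contDiffOn_const
  have hslice : ∀ p : ℝ × X, p ∈ S →
      HasDerivWithinAt (fun h => F (h, p.2)) (P p) (Ico 0 a) p.1 := by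
    intro p hp
    have h1 : HasFDerivWithinAt F (fderivWithin ℝ F S p) S (p.1, p.2) :=
      ((hF.differentiableOn (by norm_num)) p hp).hasFDerivWithinAt
    have h2 : HasDerivWithinAt (fun h : ℝ => (h, p.2)) ((1 : ℝ), (0 : X)) (Ico 0 a) p.1 :=
      (hasDerivWithinAt_id _ _).prodMk (hasDerivWithinAt_const _ _ _)
    have h3 : MapsTo (fun h : ℝ => (h, p.2)) (Ico 0 a) S := fun h hh => ⟨hh, hp.2⟩
    exact h1.comp_hasDerivWithinAt p.1 h2 h3
  have hP0 : ∀ z ∈ Metric.ball z₀ r, P (0, z) = B z := fun z hz =>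
    (uniqueDiffOn_Ico 0 a 0 ⟨le_rfl, ha⟩).eq_deriv _ (hslice _ (hmem z hz)) (hB z hz)
  have hPslice : ∀ p : ℝ × X, p ∈ S → HasFDerivAt (fun z => P (p.1, z))
      ((fderivWithin ℝ P S p).comp (ContinuousLinearMap.inr ℝ ℝ X)) p.2 := by
    intro p hp
    have h1 : HasFDerivWithinAt P (fderivWithin ℝ P S p) S (p.1, p.2) :=
      ((hPC.differentiableOn one_ne_zero) p hp).hasFDerivWithinAt
    have h2 : HasFDerivWithinAt (fun z : X => (p.1, z)) (ContinuousLinearMap.inr ℝ ℝ X)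
        (Metric.ball z₀ r) p.2 := (hasFDerivAt_prodMk_right p.1 p.2).hasFDerivWithinAt
    exact (h1.comp p.2 h2 fun z hz => ⟨hp.1, hz⟩).hasFDerivAt (Metric.isOpen_ball.mem_nhds hp.2)
  have hQ0 : (fderivWithin ℝ P S (0, z₀)).comp (ContinuousLinearMap.inr ℝ ℝ X) = B := by
    refine (hPslice _ (hmem z₀ hz₀)).unique (B.hasFDerivAt.congr_of_eventuallyEq ?_)
    filter_upwards [Metric.isOpen_ball.mem_nhds hz₀] with z hz using hP0 z hz
  have hcont : ContinuousWithinAt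
      (fun p => (fderivWithin ℝ P S p).comp (ContinuousLinearMap.inr ℝ ℝ X)) S (0, z₀) :=
    ((hPC.continuousOn_fderivWithin hS le_rfl) _ (hmem z₀ hz₀)).clm_comp continuousWithinAt_const
  obtain ⟨δ₀, hδ₀, hclose⟩ := Metric.continuousWithinAt_iff.1 hcont ε hε
  refine ⟨min δ₀ (min a r), by positivity, (min_le_right _ _).trans (min_le_left _ _),
    (min_le_right _ _).trans (min_le_right _ _), ?_⟩
  intro h hh z hz z' hz'
  set δ := min δ₀ (min a r) with hδ
  have hδδ₀ : δ ≤ δ₀ := min_le_left _ _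
  have hδa : δ ≤ a := (min_le_right _ _).trans (min_le_left _ _)
  have hδr : δ ≤ r := (min_le_right _ _).trans (min_le_right _ _)
  have hSδ : ∀ s ∈ Ico 0 δ, ∀ w ∈ Metric.ball z₀ δ, (s, w) ∈ S := fun s hs w hw =>
    ⟨⟨hs.1, hs.2.trans_le hδa⟩, Metric.ball_subset_ball hδr hw⟩
  have hPlip : ∀ s ∈ Ico 0 δ, ‖P (s, z) - P (s, z') - B (z - z')‖ ≤ ε * ‖z - z'‖ := by
    intro s hs
    have key := (convex_ball z₀ δ).norm_image_sub_le_of_norm_hasFDerivWithin_le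
      (f := fun w => P (s, w) - B w)
      (f' := fun w => (fderivWithin ℝ P S (s, w)).comp (ContinuousLinearMap.inr ℝ ℝ X) - B)
      (C := ε)
      (fun w hw => ((hPslice _ (hSδ s hs w hw)).sub B.hasFDerivAt).hasFDerivWithinAt)
      (fun w hw => by
        have := hclose (hSδ s hs w hw) (by
          rw [Prod.dist_eq, max_lt_iff]
          refine ⟨?_, lt_of_lt_of_le hw hδδ₀⟩
          simpa [Real.dist_eq, abs_of_nonneg hs.1] using hs.2.trans_le hδδ₀)
        rw [hQ0, dist_eq_norm] at this
        exact this.le) hz' hz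
    convert! key using 2
    rw [map_sub]; abel
  have key := norm_image_sub_le_of_norm_deriv_le_segment'
    (f := fun s => F (s, z) - F (s, z') - (A (z - z') + s • B (z - z')))
    (f' := fun s => P (s, z) - P (s, z') - B (z - z')) (a := 0) (b := h) (C := ε * ‖z - z'‖)
    (fun s hs => by
      have hs' : s ∈ Ico 0 δ := ⟨hs.1, hs.2.trans_lt hh.2⟩
      have h1 := (hslice (s, z) (hSδ s hs' z hz)).sub (hslice (s, z') (hSδ s hs' z' hz'))
      have h2 : HasDerivWithinAt (fun s : ℝ => A (z - z') + s • B (z - z')) (B (z - z'))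
          (Ico 0 a) s := by
        simpa using ((hasDerivWithinAt_id s (Ico 0 a)).smul_const (B (z - z'))).const_add
          (A (z - z'))
      exact (h1.sub h2).mono fun t ht => ⟨ht.1, ht.2.trans_lt (hh.2.trans_le hδa)⟩)
    (fun s hs => hPlip s ⟨hs.1, hs.2.trans hh.2⟩) h ⟨hh.1, le_rfl⟩
  have e0 : F (0, z) - F (0, z') - (A (z - z') + (0 : ℝ) • B (z - z')) = 0 := by
    rw [hA z (Metric.ball_subset_ball hδr hz), hA z' (Metric.ball_subset_ball hδr hz')]
    simp
  simp only [e0, sub_zero] at key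
  linarith

/-- The pair of maps `(F, H)` in the variables (first map, difference quotient). -/
noncomputable def rescaledPair (F H : ℝ × (E × E) → E) (h : ℝ) (z : E × E) : E × E :=
  (F (h, z), h⁻¹ • (F (h, z) - H (h, z)))

theorem rescaledPair_eq_iff {F H : ℝ × (E × E) → E} {h : ℝ} (hh : h ≠ 0) {z w : E × E} :
    rescaledPair F H h z = w ↔ F (h, z) = w.1 ∧ H (h, z) = w.1 - h • w.2 := by
  rw [rescaledPair, Prod.ext_iff]
  refine and_congr_right fun h1 => ?_
  simp only at h1 ⊢
  rw [inv_smul_eq_iff₀ hh, h1, sub_eq_iff_eq_add, eq_sub_iff_add_eq, eq_comm, add_comm]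

/-- Dividing by `h` is harmless because the Lipschitz remainders of `F` and `H` already carry a
factor `h`. The linear parts combine to `(c - d) • z.2 = z.2`, so the limit is exactly the identity.
-/
theorem exists_approximatesLinearOn_rescaledPair {F H : ℝ × (E × E) → E} {a r c d : ℝ}
    (ha : 0 < a) (hr : 0 < r) {z₀ : E × E} (hcd : c - d = 1)
    (hF : ContDiffOn ℝ 2 F (Ico 0 a ×ˢ Metric.ball z₀ r))
    (hH : ContDiffOn ℝ 2 H (Ico 0 a ×ˢ Metric.ball z₀ r))
    (hF0 : ∀ z ∈ Metric.ball z₀ r, F (0, z) = z.1) (hH0 : ∀ z ∈ Metric.ball z₀ r, H (0, z) = z.1)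
    (hF1 : ∀ z ∈ Metric.ball z₀ r,
      HasDerivWithinAt (fun h => F (h, z)) (c • z.2) (Ico 0 a) 0)
    (hH1 : ∀ z ∈ Metric.ball z₀ r,
      HasDerivWithinAt (fun h => H (h, z)) (d • z.2) (Ico 0 a) 0) :
    (∃ δ, 0 < δ ∧ δ ≤ a ∧ δ ≤ r ∧ ∀ h ∈ Ioo 0 δ,
      ApproximatesLinearOn (rescaledPair F H h)
        (ContinuousLinearEquiv.refl ℝ (E × E) : E × E →L[ℝ] E × E)
        (Metric.ball z₀ δ) (1 / 2)) ∧
    Tendsto (fun h => rescaledPair F H h z₀) (𝓝[>] 0) (𝓝 z₀) := by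
  constructor
  · obtain ⟨δ₁, h₁, h₁a, h₁r, H₁⟩ := exists_lipschitz_remainder ha hr hF
      (ContinuousLinearMap.fst ℝ E E) (c • ContinuousLinearMap.snd ℝ E E) hF0 hF1
      (ε := 1 / 4) (by norm_num)
    obtain ⟨δ₂, h₂, h₂a, h₂r, H₂⟩ := exists_lipschitz_remainder ha hr hH
      (ContinuousLinearMap.fst ℝ E E) (d • ContinuousLinearMap.snd ℝ E E) hH0 hH1
      (ε := 1 / 4) (by norm_num)
    -- The first component has error at most `h (1/4 + |c|)`, kept below `1/2` by this bound on `h`.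
    -- The second has `(h/4 + h/4) / h = 1/2`, whence the choice `ε = 1/4`.
    refine ⟨min (1 / (2 * (1 + |c|))) (min δ₁ δ₂), by positivity,
      (min_le_right _ _).trans ((min_le_left _ _).trans h₁a),
      (min_le_right _ _).trans ((min_le_left _ _).trans h₁r), ?_⟩
    intro h hh z hz z' hz'
    have hδ₁ : min (1 / (2 * (1 + |c|))) (min δ₁ δ₂) ≤ δ₁ :=
      (min_le_right _ _).trans (min_le_left _ _)
    have hδ₂ : min (1 / (2 * (1 + |c|))) (min δ₁ δ₂) ≤ δ₂ :=
      (min_le_right _ _).trans (min_le_right _ _)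
    have e₁ := H₁ h ⟨hh.1.le, hh.2.trans_le hδ₁⟩ z (Metric.ball_subset_ball hδ₁ hz) z'
      (Metric.ball_subset_ball hδ₁ hz')
    have e₂ := H₂ h ⟨hh.1.le, hh.2.trans_le hδ₂⟩ z (Metric.ball_subset_ball hδ₂ hz) z'
      (Metric.ball_subset_ball hδ₂ hz')
    have hc : h * (1 + |c|) ≤ 1 / 2 := by
      have h3 := hh.2.trans_le (min_le_left _ _)
      rw [lt_div_iff₀ (by positivity)] at h3
      linarith
    have h0 : (0 : ℝ) < h := hh.1
    have hcoe : (((1 / 2 : NNReal)) : ℝ) = 1 / 2 := by norm_num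
    rw [hcoe]
    simp only [ContinuousLinearMap.coe_fst', ContinuousLinearMap.coe_snd',
      smul_apply] at e₁ e₂
    have hsnd : ‖(z - z').2‖ ≤ ‖z - z'‖ := norm_snd_le _
    refine (norm_prod_le_iff).2 ⟨?_, ?_⟩
    · have : (rescaledPair F H h z - rescaledPair F H h z' -
          (ContinuousLinearEquiv.refl ℝ (E × E) : E × E →L[ℝ] E × E) (z - z')).1 =
          (F (h, z) - F (h, z') - ((z - z').1 + h • c • (z - z').2)) + h • c • (z - z').2 := by
        simp [rescaledPair]
        abel
      rw [this]
      refine (norm_add_le _ _).trans ((add_le_add_left e₁ _).trans ?_)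
      rw [norm_smul, norm_smul, Real.norm_eq_abs, Real.norm_eq_abs, abs_of_pos h0]
      have : h * (|c| * ‖(z - z').2‖) ≤ h * (|c| * ‖z - z'‖) := by gcongr
      nlinarith [norm_nonneg (z - z'), mul_nonneg h0.le (norm_nonneg (z - z'))]
    · have : (rescaledPair F H h z - rescaledPair F H h z' -
          (ContinuousLinearEquiv.refl ℝ (E × E) : E × E →L[ℝ] E × E) (z - z')).2 =
          h⁻¹ • ((F (h, z) - F (h, z') - ((z - z').1 + h • c • (z - z').2)) -
            (H (h, z) - H (h, z') - ((z - z').1 + h • d • (z - z').2))) := by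
        have h4 : h⁻¹ • h • (c - d) • (z - z').2 = (z - z').2 := by
          rw [inv_smul_smul₀ h0.ne', hcd, one_smul]
        have h5 : (F (h, z) - F (h, z') - ((z - z').1 + h • c • (z - z').2)) -
            (H (h, z) - H (h, z') - ((z - z').1 + h • d • (z - z').2)) =
            (F (h, z) - H (h, z)) - (F (h, z') - H (h, z')) - h • (c - d) • (z - z').2 := by
          rw [sub_smul, smul_sub]; abel
        rw [h5, smul_sub, h4, smul_sub]
        simp [rescaledPair]
      rw [this, norm_smul, norm_inv, Real.norm_eq_abs, abs_of_pos h0, inv_mul_le_iff₀ h0]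
      refine (norm_sub_le _ _).trans ((add_le_add e₁ e₂).trans (le_of_eq ?_))
      ring
  · have hz₀ := Metric.mem_ball_self (x := z₀) hr
    have hle : 𝓝[>] (0 : ℝ) ≤ 𝓝[Ico 0 a] 0 := by
      rw [← nhdsWithin_Ioo_eq_nhdsGT ha]
      exact nhdsWithin_mono _ Ioo_subset_Ico_self
    refine Tendsto.prodMk_nhds ?_ ?_
    · have := (hF1 z₀ hz₀).continuousWithinAt.tendsto
      rw [hF0 z₀ hz₀] at this
      exact this.mono_left hle
    · have := ((hF1 z₀ hz₀).sub (hH1 z₀ hz₀))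
      -- `F - H` vanishes at `h = 0`, so the second component is its slope there.
      rw [← sub_smul, hcd, one_smul, hasDerivWithinAt_iff_tendsto_slope] at this
      have h2 : 𝓝[>] (0 : ℝ) ≤ 𝓝[Ico 0 a \ {0}] 0 := by
        rw [← nhdsWithin_Ioo_eq_nhdsGT ha]
        exact nhdsWithin_mono _ fun x hx => ⟨⟨hx.1.le, hx.2⟩, hx.1.ne'⟩
      refine (this.mono_left h2).congr fun h => ?_
      simp [slope_def_module, hF0 z₀ hz₀, hH0 z₀ hz₀]

end Analysis

/-! ### Local diffeomorphisms, submersions and the inverse function theorem. -/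

section LocalDiffeomorphisms

variable {E : Type*} [NormedAddCommGroup E] [NormedSpace ℝ E]
  {F : Type*} [NormedAddCommGroup F] [NormedSpace ℝ F]
  {F' : Type*} [NormedAddCommGroup F'] [NormedSpace ℝ F']
  {F'' : Type*} [NormedAddCommGroup F''] [NormedSpace ℝ F'']
  {H : Type*} [TopologicalSpace H] {H₂ : Type*} [TopologicalSpace H₂]
  {H₃ : Type*} [TopologicalSpace H₃] {H₄ : Type*} [TopologicalSpace H₄]
  {I : ModelWithCorners ℝ E H} {J : ModelWithCorners ℝ F H₂} {K : ModelWithCorners ℝ F' H₃}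
  {L : ModelWithCorners ℝ F'' H₄}
  {M : Type*} [TopologicalSpace M] [ChartedSpace H M]
  {N : Type*} [TopologicalSpace N] [ChartedSpace H₂ N]
  {P : Type*} [TopologicalSpace P] [ChartedSpace H₃ P]
  {Q : Type*} [TopologicalSpace Q] [ChartedSpace H₄ Q]
  {N' : Type*} [TopologicalSpace N'] [ChartedSpace H N']
  {n : WithTop ℕ∞}

/-- The restriction of a partial diffeomorphism to an open set. -/
noncomputable def PartialDiffeomorph.restrOpen (Φ : PartialDiffeomorph I J M N n) (s : Set M) (hs : IsOpen s) :
    PartialDiffeomorph I J M N n where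
  toPartialEquiv := (Φ.toOpenPartialHomeomorph.restrOpen s hs).toPartialEquiv
  open_source := (Φ.toOpenPartialHomeomorph.restrOpen s hs).open_source
  open_target := (Φ.toOpenPartialHomeomorph.restrOpen s hs).open_target
  contMDiffOn_toFun := Φ.contMDiffOn_toFun.mono inter_subset_left
  contMDiffOn_invFun := Φ.contMDiffOn_invFun.mono inter_subset_left

theorem IsLocalDiffeomorphAt.congr_of_eventuallyEq {f g : M → N} {x : M}
    (hf : IsLocalDiffeomorphAt I J n f x) (h : g =ᶠ[𝓝 x] f) : IsLocalDiffeomorphAt I J n g x := by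
  obtain ⟨Φ, hx, hΦ⟩ := hf
  obtain ⟨s, hs, hso, hxs⟩ := eventually_nhds_iff.1 h
  exact ⟨Φ.restrOpen s hso, ⟨hx, hxs⟩, fun y hy => (hs y hy.2).trans (hΦ hy.1)⟩

theorem IsLocalDiffeomorphAt.of_le {f : M → N} {x : M} {m : WithTop ℕ∞}
    (hf : IsLocalDiffeomorphAt I J n f x) (hmn : m ≤ n) : IsLocalDiffeomorphAt I J m f x := by
  obtain ⟨Φ, hx, hΦ⟩ := hf
  exact ⟨{ toPartialEquiv := Φ.toPartialEquiv
           open_source := Φ.open_source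
           open_target := Φ.open_target
           contMDiffOn_toFun := Φ.contMDiffOn_toFun.of_le hmn
           contMDiffOn_invFun := Φ.contMDiffOn_invFun.of_le hmn }, hx, hΦ⟩

theorem IsLocalDiffeomorphAt.prodMap {f : M → N} {g : P → Q} {x : M} {y : P}
    (hf : IsLocalDiffeomorphAt I J n f x) (hg : IsLocalDiffeomorphAt K L n g y) :
    IsLocalDiffeomorphAt (I.prod K) (J.prod L) n (Prod.map f g) (x, y) := by
  obtain ⟨Φ, hx, hΦ⟩ := hf
  obtain ⟨Ψ, hy, hΨ⟩ := hg
  refine ⟨{ toPartialEquiv := Φ.toPartialEquiv.prod Ψ.toPartialEquiv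
            open_source := Φ.open_source.prod Ψ.open_source
            open_target := Φ.open_target.prod Ψ.open_target
            contMDiffOn_toFun := Φ.contMDiffOn_toFun.prodMap Ψ.contMDiffOn_toFun
            contMDiffOn_invFun := Φ.contMDiffOn_invFun.prodMap Ψ.contMDiffOn_invFun }, ⟨hx, hy⟩, ?_⟩
  exact fun p hp => Prod.ext (hΦ hp.1) (hΨ hp.2)

/-- If `j ∘ g` and `j` are local diffeomorphisms and `g` is continuous, then `g` is a local
diffeomorphism. -/
theorem IsLocalDiffeomorphAt.of_comp_left {g : M → N} {j : N → P} {x : M}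
    (hj : IsLocalDiffeomorphAt J K n j (g x)) (hg : ContinuousAt g x)
    (h : IsLocalDiffeomorphAt I K n (j ∘ g) x) : IsLocalDiffeomorphAt I J n g x := by
  have h1 : IsLocalDiffeomorphAt I J n (hj.localInverse ∘ (j ∘ g)) x :=
    IsLocalDiffeomorphAt.comp (hf := h) (hg := hj.localInverse_isLocalDiffeomorphAt)
  refine h1.congr_of_eventuallyEq ?_
  filter_upwards [hg.eventually hj.localInverse_eventuallyEq_left] with y hy using hy.symm

theorem contMDiffAt_subtype_val_comp_iff {U : Opens N} {f : M → U} {x : M} :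
    ContMDiffAt I J n (fun y => (f y : N)) x ↔ ContMDiffAt I J n f x :=
  ChartedSpace.liftPropWithinAt_subtypeVal_comp_iff f univ x

theorem isLocalDiffeomorph_subtype_val (U : Opens M) :
    IsLocalDiffeomorph I I n (Subtype.val : U → M) := by
  intro x
  have : Nonempty U := ⟨x⟩
  let e := U.openPartialHomeomorphSubtypeCoe ⟨x⟩
  refine ⟨{ toPartialEquiv := e.toPartialEquiv
            open_source := e.open_source
            open_target := e.open_target
            contMDiffOn_toFun := contMDiff_subtype_val.contMDiffOn
            contMDiffOn_invFun := fun y hy => ?_ }, by simp [e], fun y _ => rfl⟩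
  refine ContMDiffAt.contMDiffWithinAt (contMDiffAt_subtype_val_comp_iff.1 ?_)
  refine contMDiffAt_id.congr_of_eventuallyEq ?_
  filter_upwards [e.open_target.mem_nhds hy] with w hw using e.right_inv hw

theorem isLocalDiffeomorphAt_extChartAt [IsManifold I n M] [I.Boundaryless] {x y : M}
    (hy : y ∈ (extChartAt I x).source) :
    IsLocalDiffeomorphAt I 𝓘(ℝ, E) n (extChartAt I x) y :=
  ⟨{ toPartialEquiv := extChartAt I x
     open_source := isOpen_extChartAt_source x
     open_target := isOpen_extChartAt_target x
     contMDiffOn_toFun := by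
      rw [extChartAt_source]
      exact contMDiffOn_extChartAt
     contMDiffOn_invFun := contMDiffOn_extChartAt_symm x }, hy, fun _ _ => rfl⟩

theorem isLocalDiffeomorphAt_extChartAt_symm [IsManifold I n M] [I.Boundaryless] {x : M} {z : E}
    (hz : z ∈ (extChartAt I x).target) :
    IsLocalDiffeomorphAt 𝓘(ℝ, E) I n (extChartAt I x).symm z :=
  ⟨{ toPartialEquiv := (extChartAt I x).symm
     open_source := isOpen_extChartAt_target x
     open_target := isOpen_extChartAt_source x
     contMDiffOn_toFun := contMDiffOn_extChartAt_symm x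
     contMDiffOn_invFun := by
      rw [PartialEquiv.symm_target, extChartAt_source]
      exact contMDiffOn_extChartAt }, hz, fun _ _ => rfl⟩

/-- The inverse function theorem for a map that is `1/2`-close to the identity. -/
theorem ApproximatesLinearOn.isLocalDiffeomorphAt [CompleteSpace E] {f : E → E} {s : Set E}
    (hs : IsOpen s) (hf : ApproximatesLinearOn f (ContinuousLinearEquiv.refl ℝ E : E →L[ℝ] E) s
      (1 / 2)) (hn : n ≠ 0) (hfn : ContDiffOn ℝ n f s) {x : E} (hx : x ∈ s) :
    IsLocalDiffeomorphAt 𝓘(ℝ, E) 𝓘(ℝ, E) n f x := by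
  -- The identity has norm `1` only on a nontrivial space.
  have hc : Subsingleton E ∨
      (1 / 2 : NNReal) < ‖((ContinuousLinearEquiv.refl ℝ E).symm : E →L[ℝ] E)‖₊⁻¹ := by
    rcases subsingleton_or_nontrivial E with h | h
    · exact Or.inl h
    refine Or.inr ?_
    have : ‖((ContinuousLinearEquiv.refl ℝ E).symm : E →L[ℝ] E)‖₊ = 1 := by
      ext
      exact ContinuousLinearMap.norm_id
    rw [this, inv_one]
    exact NNReal.half_lt_self one_ne_zero
  let e := hf.toOpenPartialHomeomorph f s hc hs
  have hequiv : ∀ y ∈ s, ∃ A : E ≃L[ℝ] E, HasFDerivAt f (A : E →L[ℝ] E) y := by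
    intro y hy
    have hd : HasFDerivAt f (fderiv ℝ f y) y :=
      (((hfn.differentiableOn hn) y hy).differentiableAt (hs.mem_nhds hy)).hasFDerivAt
    have hle : ‖fderiv ℝ f y - ContinuousLinearMap.id ℝ E‖ ≤ 1 / 2 := by
      refine (hd.sub (ContinuousLinearMap.id ℝ E).hasFDerivAt).le_of_lip' (by norm_num) ?_
      filter_upwards [hs.mem_nhds hy] with w hw
      have := hf w hw y hy
      simp only [ContinuousLinearEquiv.coe_refl, ContinuousLinearMap.id_apply] at this ⊢
      convert! this using 2
      simp only [Pi.sub_apply, ContinuousLinearMap.id_apply]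
      abel
    have hlt : ‖ContinuousLinearMap.id ℝ E - fderiv ℝ f y‖ < 1 := by
      rw [norm_sub_rev]
      linarith
    -- The derivative is within `1/2` of the identity, hence invertible by the Neumann series; this
    -- makes the inverse homeomorphism as smooth as `f`.
    let u : (E →L[ℝ] E)ˣ := Units.oneSub (ContinuousLinearMap.id ℝ E - fderiv ℝ f y) hlt
    refine ⟨ContinuousLinearEquiv.unitsEquiv ℝ E u, ?_⟩
    convert! hd
    ext w
    simp [u]
  refine ⟨{ toPartialEquiv := e.toPartialEquiv
            open_source := e.open_source
            open_target := e.open_target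
            contMDiffOn_toFun := hfn.contMDiffOn
            contMDiffOn_invFun := ?_ }, hx, fun _ _ => rfl⟩
  intro y hy
  obtain ⟨A, hA⟩ := hequiv _ (e.map_target hy)
  exact (e.contDiffAt_symm hy hA
    (hfn.contDiffAt (hs.mem_nhds (e.map_target hy)))).contMDiffAt.contMDiffWithinAt

/-- The first component of a local diffeomorphism into a product is a submersion. -/
theorem IsLocalDiffeomorph.isSubmersion_fst [IsManifold I n N'] [IsManifold L n Q]
    {X : Type*} [TopologicalSpace X] [ChartedSpace (ModelProd H H₄) X]
    [IsManifold (I.prod L) n X] {g : X → N' × Q} (hg : IsLocalDiffeomorph (I.prod L) (I.prod L) n g) :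
    Manifold.IsSubmersion (I.prod L) I n fun x => (g x).1 := by
  refine Manifold.IsSubmersionOfComplement.isSubmersion (F := F'') fun x => ?_
  obtain ⟨Φ, hx, hΦ⟩ := hg x
  let c : OpenPartialHomeomorph (N' × Q) (ModelProd H H₄) :=
    (chartAt H (g x).1).prod (chartAt H₄ (g x).2)
  have hc : c ∈ IsManifold.maximalAtlas (I.prod L) n (N' × Q) :=
    IsManifold.chart_mem_maximalAtlas (I := I.prod L) (n := n) (g x)
  -- Pulling a product chart back along `g` gives a chart of `X` in which the first component of `g`
  -- is a linear projection with complement `F''`.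
  let e := Φ.toOpenPartialHomeomorph.trans c
  have he : ∀ y ∈ e.source, g y = Φ y := fun y hy => hΦ hy.1
  have hxe : x ∈ e.source := by
    refine ⟨hx, ?_⟩
    change Φ x ∈ c.source
    rw [← hΦ hx]
    exact ⟨mem_chart_source H _, mem_chart_source H₄ _⟩
  refine Manifold.IsSubmersionAtOfComplement.mk_of_charts (ContinuousLinearEquiv.refl ℝ (E × F''))
    e (chartAt H (g x).1) hxe (mem_chart_source H _) ?_
    (IsManifold.chart_mem_maximalAtlas _) ?_ ?_
  · refine e.mem_maximalAtlas_of_contMDiffOn ?_ ?_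
    · exact (contMDiffOn_of_mem_maximalAtlas hc).comp
        (Φ.contMDiffOn_toFun.mono inter_subset_left) fun y hy => hy.2
    · exact Φ.contMDiffOn_invFun.comp
        ((contMDiffOn_symm_of_mem_maximalAtlas hc).mono inter_subset_left) fun y hy => hy.2
  · intro y hy
    have h2 : Φ y ∈ c.source := hy.2
    rw [← he y hy] at h2
    exact h2.1
  · intro z hz
    have hz' : (e.extend (I.prod L)).symm z ∈ e.source := by
      rw [← e.extend_source (I := I.prod L)]
      exact (e.extend (I.prod L)).map_target hz
    have h3 : e.extend (I.prod L) ((e.extend (I.prod L)).symm z) = z :=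
      (e.extend (I.prod L)).right_inv hz
    have h4 : e.extend (I.prod L) ((e.extend (I.prod L)).symm z) =
      (I.prod L) (c (g ((e.extend (I.prod L)).symm z))) := by
      rw [he _ hz']; rfl
    rw [h4] at h3
    exact congrArg Prod.fst h3

/-- An injective local diffeomorphism into `N'` has an open range `W`, and is a diffeomorphism
onto `W`. -/
theorem IsLocalDiffeomorph.exists_diffeomorph_range {g : M → N} (hg : IsLocalDiffeomorph I J n g)
    (hinj : Function.Injective g) :
    ∃ Φ : Diffeomorph I J M hg.image n, ∀ x, (Φ x : N) = g x := by
  have hloc : IsLocalDiffeomorph I J n fun x => (⟨g x, x, rfl⟩ : hg.image) := fun x =>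
    (isLocalDiffeomorph_subtype_val hg.image _).of_comp_left
      (hg.isLocalHomeomorph.continuous.subtype_mk _).continuousAt (hg x)
  refine ⟨hloc.diffeomorphOfBijective ⟨fun x y hxy => hinj (congrArg Subtype.val hxy), ?_⟩,
    fun x => ?_⟩
  · rintro ⟨_, x, rfl⟩
    exact ⟨x, rfl⟩
  · rfl

end LocalDiffeomorphisms

/-! ### From injective local diffeomorphisms to discrete tangent bundles. -/

section DiscreteTangentBundleCriterion

variable {E : Type*} [NormedAddCommGroup E] [NormedSpace ℝ E] [FiniteDimensional ℝ E]
  {X : Type*} [TopologicalSpace X] [ChartedSpace (ModelProd E E) X]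
  [IsManifold (𝓘(ℝ, E).prod 𝓘(ℝ, E)) ∞ X] [T2Space X] [SecondCountableTopology X]
  {N : Type*} [TopologicalSpace N] [ChartedSpace E N] [IsManifold 𝓘(ℝ, E) ∞ N] {k : ℕ∞}

/-- Components of a local diffeomorphism into a product are submersions; a vector killed by both
differentials is killed by the invertible differential of `(p, q)`. The two fibres over `m` meet in
the preimage of `(m, m)`, which is one point by `hdiag` and `hinj`. -/
theorem isDiscreteTangentBundle_of_isLocalDiffeomorph (hk : k ≠ 0) {p q : X → N}
    (hloc : IsLocalDiffeomorph (𝓘(ℝ, E).prod 𝓘(ℝ, E)) (𝓘(ℝ, E).prod 𝓘(ℝ, E)) k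
      fun x => (p x, q x))
    (hinj : Function.Injective fun x => (p x, q x)) (hdiag : ∀ m, ∃ x, p x = m ∧ q x = m) :
    IsDiscreteTangentBundle (𝓘(ℝ, E).prod 𝓘(ℝ, E)) 𝓘(ℝ, E) k p q := by
  have hk' : (k : WithTop ℕ∞) ≠ 0 := by exact_mod_cast hk
  have hkTop : (k : WithTop ℕ∞) ≤ ∞ := by exact_mod_cast le_top
  have : IsManifold (𝓘(ℝ, E).prod 𝓘(ℝ, E)) k X := .of_le hkTop
  have : IsManifold 𝓘(ℝ, E) k N := .of_le hkTop
  refine ⟨inferInstance, inferInstance, ?_, hloc.isSubmersion_fst, ?_, ?_, ?_⟩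
  · rw [Module.finrank_prod, two_mul]
  · have hswap : IsLocalDiffeomorph (𝓘(ℝ, E).prod 𝓘(ℝ, E)) (𝓘(ℝ, E).prod 𝓘(ℝ, E)) k
        fun x => (q x, p x) := fun x =>
      (hloc x).comp (hg := (Diffeomorph.prodComm 𝓘(ℝ, E) 𝓘(ℝ, E) N N k).isLocalDiffeomorph _)
    exact hswap.isSubmersion_fst
  · intro v w hp hq
    have hd := (hloc v).mdifferentiableAt hk'
    apply ((hloc v).mfderivToContinuousLinearEquiv hk').injective
    rw [map_zero]
    change mfderiv _ _ _ v w = 0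
    have hpd : MDifferentiableAt (𝓘(ℝ, E).prod 𝓘(ℝ, E)) 𝓘(ℝ, E) p v := hd.fst
    have hqd : MDifferentiableAt (𝓘(ℝ, E).prod 𝓘(ℝ, E)) 𝓘(ℝ, E) q v := hd.snd
    rw [mfderiv_prodMk hpd hqd]
    exact Prod.ext hp hq
  · intro m
    obtain ⟨x, hx⟩ := hdiag m
    exact ⟨x, hx, fun y hy => hinj (Prod.ext (hy.1.trans hx.1.symm) (hy.2.trans hx.2.symm))⟩

end DiscreteTangentBundleCriterion

/-! ### Curves and boundary maps in charts of the tangent bundle. -/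

section TangentCharts

variable {E : Type*} [NormedAddCommGroup E] [NormedSpace ℝ E]
  {M : Type*} [TopologicalSpace M] [ChartedSpace E M] [IsManifold 𝓘(ℝ, E) ∞ M]

theorem extChartAt_tangent_fst (v₀ v : TangentBundle 𝓘(ℝ, E) M) :
    (extChartAt 𝓘(ℝ, E).tangent v₀ v).1 = extChartAt 𝓘(ℝ, E) v₀.proj v.proj := rfl

theorem mem_extChartAt_tangent_source {v₀ v : TangentBundle 𝓘(ℝ, E) M} :
    v ∈ (extChartAt 𝓘(ℝ, E).tangent v₀).source ↔ v.proj ∈ (extChartAt 𝓘(ℝ, E) v₀.proj).source := by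
  rw [extChartAt_source, extChartAt_source]
  exact TangentBundle.mem_chart_source_iff v v₀

/-- The fibre coordinate is linear in the vector and agrees with the derivative of a curve read in
the base chart. -/
theorem extChartAt_tangent_snd {v₀ v : TangentBundle 𝓘(ℝ, E) M}
    (hv : v.proj ∈ (extChartAt 𝓘(ℝ, E) v₀.proj).source) :
    (extChartAt 𝓘(ℝ, E).tangent v₀ v).2 =
      mfderiv 𝓘(ℝ, E) 𝓘(ℝ, E) (extChartAt 𝓘(ℝ, E) v₀.proj) v.proj v.snd := by
  rw [extChartAt_source] at hv
  have h := mfderiv_chartAt_eq_tangentCoordChange (I := 𝓘(ℝ, E)) hv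
  have h' : mfderiv 𝓘(ℝ, E) 𝓘(ℝ, E) (extChartAt 𝓘(ℝ, E) v₀.proj) v.proj =
    tangentCoordChange 𝓘(ℝ, E) v.proj v₀.proj v.proj := h
  rw [h']
  rfl

theorem extChartAt_tangent_smul_snd {v₀ v : TangentBundle 𝓘(ℝ, E) M}
    (hv : v.proj ∈ (extChartAt 𝓘(ℝ, E) v₀.proj).source) (c : ℝ) :
    (extChartAt 𝓘(ℝ, E).tangent v₀ ⟨v.proj, c • v.snd⟩).2 =
      c • (extChartAt 𝓘(ℝ, E).tangent v₀ v).2 := by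
  rw [extChartAt_tangent_snd hv,
    extChartAt_tangent_snd (v := (⟨v.proj, c • v.snd⟩ : TangentBundle 𝓘(ℝ, E) M)) hv]
  exact map_smul _ _ _

/-- The velocity of a curve, read in a chart. -/
theorem HasVelocityWithinAt.hasDerivWithinAt_extChartAt {c : ℝ → M} {s : Set ℝ} {t : ℝ}
    {v v₀ : TangentBundle 𝓘(ℝ, E) M} (h : HasVelocityWithinAt c s t v)
    (hv : v.proj ∈ (extChartAt 𝓘(ℝ, E) v₀.proj).source) :
    HasDerivWithinAt (fun r => extChartAt 𝓘(ℝ, E) v₀.proj (c r))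
      (extChartAt 𝓘(ℝ, E).tangent v₀ v).2 s t := by
  obtain ⟨hc, rfl⟩ := h
  have : IsManifold 𝓘(ℝ, E) 1 M := .of_le (n := ∞) (by exact_mod_cast le_top)
  rw [extChartAt_source] at hv
  have h1 : HasMFDerivWithinAt 𝓘(ℝ, ℝ) 𝓘(ℝ, E) (extChartAt 𝓘(ℝ, E) v₀.proj ∘ c) s t _ :=
    HasMFDerivAt.comp_hasMFDerivWithinAt t
      (mdifferentiableAt_extChartAt (I := 𝓘(ℝ, E)) hv).hasMFDerivAt hc.hasMFDerivWithinAt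
  rw [← extChartAt_source 𝓘(ℝ, E)] at hv
  rw [extChartAt_tangent_snd hv]
  let L : ℝ →L[ℝ] E := (mfderiv 𝓘(ℝ, E) 𝓘(ℝ, E) (extChartAt 𝓘(ℝ, E) v₀.proj) (c t)).comp
    (mfderivWithin 𝓘(ℝ, ℝ) 𝓘(ℝ, E) c s t)
  have h2 : HasFDerivWithinAt (fun r => extChartAt 𝓘(ℝ, E) v₀.proj (c r)) L s t :=
    hasMFDerivWithinAt_iff_hasFDerivWithinAt.1 h1
  exact h2.hasDerivWithinAt

/-- A `C^k` family of maps `β h : TM → M` with `β 0 v = v.proj` and `∂β/∂h (0, v) = c • v`, read in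
a chart. -/
theorem exists_ball_contDiffOn_chart {β : ℝ → TangentBundle 𝓘(ℝ, E) M → M}
    {S : Set (ℝ × TangentBundle 𝓘(ℝ, E) M)} {a c : ℝ} {k : ℕ∞} (ha : 0 < a)
    (v₀ : TangentBundle 𝓘(ℝ, E) M) (hS : S ∈ 𝓝[Ico 0 a ×ˢ univ] (0, v₀))
    (hβ : ContMDiffOn (𝓘(ℝ, ℝ).prod 𝓘(ℝ, E).tangent) 𝓘(ℝ, E) k
      (fun p : ℝ × TangentBundle 𝓘(ℝ, E) M => β p.1 p.2) S)
    (hvel : ∀ v, HasVelocityWithinAt (fun h => β h v) (Ico 0 a) 0 ⟨v.proj, c • v.snd⟩) :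
    ∃ δ, 0 < δ ∧ δ ≤ a ∧
      Metric.ball (extChartAt 𝓘(ℝ, E).tangent v₀ v₀) δ ⊆ (extChartAt 𝓘(ℝ, E).tangent v₀).target ∧
      (∀ h ∈ Ico 0 δ, ∀ z ∈ Metric.ball (extChartAt 𝓘(ℝ, E).tangent v₀ v₀) δ,
        (h, (extChartAt 𝓘(ℝ, E).tangent v₀).symm z) ∈ S ∧
        β h ((extChartAt 𝓘(ℝ, E).tangent v₀).symm z) ∈ (extChartAt 𝓘(ℝ, E) v₀.proj).source) ∧
      ContDiffOn ℝ k (fun p : ℝ × (E × E) => extChartAt 𝓘(ℝ, E) v₀.proj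
        (β p.1 ((extChartAt 𝓘(ℝ, E).tangent v₀).symm p.2)))
        (Ico 0 δ ×ˢ Metric.ball (extChartAt 𝓘(ℝ, E).tangent v₀ v₀) δ) ∧
      ∀ z ∈ Metric.ball (extChartAt 𝓘(ℝ, E).tangent v₀ v₀) δ,
        extChartAt 𝓘(ℝ, E) v₀.proj (β 0 ((extChartAt 𝓘(ℝ, E).tangent v₀).symm z)) = z.1 ∧
        HasDerivWithinAt (fun h => extChartAt 𝓘(ℝ, E) v₀.proj
          (β h ((extChartAt 𝓘(ℝ, E).tangent v₀).symm z))) (c • z.2) (Ico 0 a) 0 := by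
  set e := extChartAt 𝓘(ℝ, E).tangent v₀ with he
  set φ := extChartAt 𝓘(ℝ, E) v₀.proj with hφ
  have hkTop : (k : WithTop ℕ∞) ≤ ∞ := by exact_mod_cast le_top
  have : IsManifold 𝓘(ℝ, E) k M := .of_le hkTop
  have : IsManifold 𝓘(ℝ, E).tangent k (TangentBundle 𝓘(ℝ, E) M) := .of_le hkTop
  -- An equality of tangent vectors includes equality of their base points.
  have hβ0 : ∀ v, β 0 v = v.proj := fun v => congrArg Bundle.TotalSpace.proj (hvel v).2
  have hT₀ : ((0 : ℝ), v₀) ∈ Ico 0 a ×ˢ (univ : Set (TangentBundle 𝓘(ℝ, E) M)) :=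
    ⟨⟨le_rfl, ha⟩, mem_univ _⟩
  have hS₀ : ((0 : ℝ), v₀) ∈ S := mem_of_mem_nhdsWithin hT₀ hS
  have hesymm : e.symm (e v₀) = v₀ := extChartAt_to_inv v₀
  have hgood : {p : ℝ × TangentBundle 𝓘(ℝ, E) M | p ∈ S ∧ β p.1 p.2 ∈ φ.source} ∈
      𝓝[Ico 0 a ×ˢ univ] (0, v₀) := by
    refine inter_mem hS (nhdsWithin_le_of_mem hS ?_)
    refine (hβ.continuousOn _ hS₀).preimage_mem_nhdsWithin ?_
    simp only [hβ0]
    exact extChartAt_source_mem_nhds v₀.proj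
  have hgood' : {p : ℝ × (E × E) | p.2 ∈ e.target ∧ (p.1, e.symm p.2) ∈ S ∧
      β p.1 (e.symm p.2) ∈ φ.source} ∈ 𝓝[Ico 0 a ×ˢ univ] ((0 : ℝ), e v₀) := by
    have hc : ContinuousAt (fun p : ℝ × (E × E) => (p.1, e.symm p.2)) ((0 : ℝ), e v₀) :=
      continuousAt_fst.prodMk ((continuousAt_extChartAt_symm v₀).comp
        (f := fun p : ℝ × (E × E) => p.2) (x := ((0 : ℝ), e v₀)) continuousAt_snd)
    refine inter_mem (mem_nhdsWithin_of_mem_nhds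
      (continuousAt_snd.preimage_mem_nhds (t := e.target)
        (extChartAt_target_mem_nhds (I := 𝓘(ℝ, E).tangent) v₀))) ?_
    have ht : Tendsto (fun p : ℝ × (E × E) => (p.1, e.symm p.2))
        (𝓝[Ico 0 a ×ˢ univ] ((0 : ℝ), e v₀)) (𝓝[Ico 0 a ×ˢ univ] (0, v₀)) := by
      refine tendsto_nhdsWithin_iff.2 ⟨?_, ?_⟩
      · have := hc.tendsto
        simp only [hesymm] at this
        exact this.mono_left nhdsWithin_le_nhds
      · filter_upwards [self_mem_nhdsWithin] with p hp using ⟨hp.1, mem_univ _⟩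
    exact ht hgood
  obtain ⟨δ, hδ, hball⟩ := Metric.mem_nhdsWithin_iff.1 hgood'
  have hmem : ∀ h ∈ Ico 0 (min δ a), ∀ z ∈ Metric.ball (e v₀) (min δ a), z ∈ e.target ∧
      (h, e.symm z) ∈ S ∧ β h (e.symm z) ∈ φ.source := by
    intro h hh z hz
    refine @hball (h, z) ⟨?_, ⟨hh.1, hh.2.trans_le (min_le_right _ _)⟩, mem_univ _⟩
    rw [Metric.mem_ball, Prod.dist_eq, max_lt_iff]
    refine ⟨?_, lt_of_lt_of_le hz (min_le_left _ _)⟩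
    simpa [Real.dist_eq, abs_of_nonneg hh.1] using hh.2.trans_le (min_le_left _ _)
  have hδ' : 0 < min δ a := lt_min hδ ha
  have hsub : Metric.ball (e v₀) (min δ a) ⊆ e.target := fun z hz =>
    (hmem 0 ⟨le_rfl, hδ'⟩ z hz).1
  refine ⟨min δ a, hδ', min_le_right _ _, hsub, fun h hh z hz => (hmem h hh z hz).2, ?_, ?_⟩
  · have h1 : ContMDiffOn (𝓘(ℝ, ℝ).prod 𝓘(ℝ, E × E)) (𝓘(ℝ, ℝ).prod 𝓘(ℝ, E).tangent) k
        (fun p : ℝ × (E × E) => (p.1, e.symm p.2))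
        (Ico 0 (min δ a) ×ˢ Metric.ball (e v₀) (min δ a)) :=
      contMDiffOn_fst.prodMk ((contMDiffOn_extChartAt_symm v₀).comp contMDiffOn_snd
        fun p hp => hsub hp.2)
    have h2 := hβ.comp h1 fun p hp => (hmem p.1 hp.1 p.2 hp.2).2.1
    have h3 : ContMDiffOn (𝓘(ℝ, ℝ).prod 𝓘(ℝ, E × E)) 𝓘(ℝ, E) k
        (fun p : ℝ × (E × E) => φ (β p.1 (e.symm p.2)))
        (Ico 0 (min δ a) ×ˢ Metric.ball (e v₀) (min δ a)) :=
      (contMDiffOn_extChartAt (I := 𝓘(ℝ, E)) (x := v₀.proj) (n := k)).comp h2 fun p hp => by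
        have := (hmem p.1 hp.1 p.2 hp.2).2.2
        rwa [hφ, extChartAt_source] at this
    -- Identifies the product manifold structure on `ℝ × (E × E)` with the vector space one.
    rw [← modelWithCornersSelf_prod, chartedSpaceSelf_prod] at h3
    exact h3.contDiffOn
  · intro z hz
    have hzt := hsub hz
    have hsrc : (e.symm z).proj ∈ φ.source :=
      mem_extChartAt_tangent_source.1 (e.map_target hzt)
    have hez : e (e.symm z) = z := e.right_inv hzt
    constructor
    · rw [hβ0, hφ, ← extChartAt_tangent_fst, ← he, hez]
    · have := (hvel (e.symm z)).hasDerivWithinAt_extChartAt (v₀ := v₀) hsrc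
      rwa [extChartAt_tangent_smul_snd hsrc, ← he, hez] at this

end TangentCharts

/-! ### Boundary maps of a discretization as `h` tends to `0`. -/

namespace TangentBundleDiscretization

variable {E : Type*} [NormedAddCommGroup E] [NormedSpace ℝ E]
  {M : Type*} [TopologicalSpace M] [ChartedSpace E M] [IsManifold 𝓘(ℝ, E) ∞ M] {k : ℕ∞}
  (D : TangentBundleDiscretization E M k)

theorem zero_mem_Ico : (0 : ℝ) ∈ Ico 0 D.a := ⟨le_rfl, D.a_pos⟩

theorem αplus_zero : D.αplus 0 = 0 := by
  have h1 := D.αplus_nonneg 0 D.zero_mem_Ico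
  have h2 := D.αminus_nonpos 0 D.zero_mem_Ico
  have h3 := D.αplus_sub_αminus 0 D.zero_mem_Ico
  linarith

theorem αminus_zero : D.αminus 0 = 0 := by
  have h := D.αplus_sub_αminus 0 D.zero_mem_Ico
  rw [D.αplus_zero] at h
  linarith

/-- This is the normalization that makes the rescaled pair converge to the identity. -/
theorem derivWithin_αplus_sub_derivWithin_αminus :
    derivWithin D.αplus (Ico 0 D.a) 0 - derivWithin D.αminus (Ico 0 D.a) 0 = 1 := by
  have h1 := (D.contDiffOn_αplus.differentiableOn one_ne_zero 0 D.zero_mem_Ico).hasDerivWithinAt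
  have h2 := (D.contDiffOn_αminus.differentiableOn one_ne_zero 0 D.zero_mem_Ico).hasDerivWithinAt
  exact (uniqueDiffOn_Ico 0 D.a 0 D.zero_mem_Ico).eq_deriv _ (h1.sub h2)
    ((hasDerivWithinAt_id _ _).congr (fun h hh => D.αplus_sub_αminus h hh)
      (D.αplus_sub_αminus 0 D.zero_mem_Ico))

theorem domain_mem_nhdsWithin {α : ℝ → ℝ} (hα : ContinuousOn α (Ico 0 D.a)) (hα0 : α 0 = 0)
    (v₀ : TangentBundle 𝓘(ℝ, E) M) :
    {p : ℝ × TangentBundle 𝓘(ℝ, E) M | p.1 ∈ Ico 0 D.a ∧ (p.1, α p.1, p.2) ∈ D.U} ∈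
      𝓝[Ico 0 D.a ×ˢ univ] (0, v₀) := by
  have hc : ContinuousWithinAt
      (fun p : ℝ × TangentBundle 𝓘(ℝ, E) M => (p.1, α p.1, p.2)) (Ico 0 D.a ×ˢ univ) (0, v₀) := by
    refine continuousWithinAt_fst.prodMk (ContinuousWithinAt.prodMk ?_ continuousWithinAt_snd)
    exact (hα 0 D.zero_mem_Ico).comp (x := ((0 : ℝ), v₀)) continuousWithinAt_fst fun p hp => hp.1
  have hU : D.U ∈ 𝓝 ((0 : ℝ), α 0, v₀) := by
    rw [hα0]
    exact D.isOpen_U.mem_nhds (D.zero_mem_U v₀)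
  filter_upwards [self_mem_nhdsWithin, hc.preimage_mem_nhdsWithin hU] with p hp hpU
    using ⟨hp.1, hpU⟩

theorem plusDomain_mem_nhdsWithin (v₀ : TangentBundle 𝓘(ℝ, E) M) :
    {p : ℝ × TangentBundle 𝓘(ℝ, E) M | p.1 ∈ Ico 0 D.a ∧ (p.1, D.αplus p.1, p.2) ∈ D.U} ∈
      𝓝[Ico 0 D.a ×ˢ univ] (0, v₀) :=
  D.domain_mem_nhdsWithin D.contDiffOn_αplus.continuousOn D.αplus_zero v₀

theorem minusDomain_mem_nhdsWithin (v₀ : TangentBundle 𝓘(ℝ, E) M) :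
    {p : ℝ × TangentBundle 𝓘(ℝ, E) M | p.1 ∈ Ico 0 D.a ∧ (p.1, D.αminus p.1, p.2) ∈ D.U} ∈
      𝓝[Ico 0 D.a ×ˢ univ] (0, v₀) :=
  D.domain_mem_nhdsWithin D.contDiffOn_αminus.continuousOn D.αminus_zero v₀

/-- The left-hand filter is the one along which the local results are stated, in the form that
compactness arguments need. -/
theorem nhdsGT_prod_nhds_le (v₀ : TangentBundle 𝓘(ℝ, E) M) :
    𝓝[>] (0 : ℝ) ×ˢ 𝓝 v₀ ≤ 𝓝[Ico 0 D.a ×ˢ univ] (0, v₀) := by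
  rw [nhdsWithin_prod_eq, nhdsWithin_univ, ← nhdsWithin_Ioo_eq_nhdsGT D.a_pos]
  exact Filter.prod_mono (nhdsWithin_mono _ Ioo_subset_Ico_self) le_rfl

theorem eventually_mem_bdryDomain (v₀ : TangentBundle 𝓘(ℝ, E) M) :
    ∀ᶠ p in 𝓝[>] (0 : ℝ) ×ˢ 𝓝 v₀, p.2 ∈ D.bdryDomain p.1 := by
  filter_upwards [D.nhdsGT_prod_nhds_le v₀ (D.plusDomain_mem_nhdsWithin v₀),
    D.nhdsGT_prod_nhds_le v₀ (D.minusDomain_mem_nhdsWithin v₀)] with p h1 h2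
    using ⟨h1.1, h1.2, h2.2⟩

theorem bdryPlus_zero (v : TangentBundle 𝓘(ℝ, E) M) : D.bdryPlus 0 v = v.proj :=
  congrArg Bundle.TotalSpace.proj (D.velocity_plus v).2

theorem bdryMinus_zero (v : TangentBundle 𝓘(ℝ, E) M) : D.bdryMinus 0 v = v.proj :=
  congrArg Bundle.TotalSpace.proj (D.velocity_minus v).2

theorem tendsto_bdryPlus (v₀ : TangentBundle 𝓘(ℝ, E) M) :
    Tendsto (fun p : ℝ × TangentBundle 𝓘(ℝ, E) M => D.bdryPlus p.1 p.2) (𝓝[>] 0 ×ˢ 𝓝 v₀)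
      (𝓝 v₀.proj) := by
  have hS := D.plusDomain_mem_nhdsWithin v₀
  have h := D.contMDiffOn_plus.continuousOn _
    (mem_of_mem_nhdsWithin (⟨D.zero_mem_Ico, mem_univ _⟩ : ((0 : ℝ), v₀) ∈ _ ×ˢ _) hS)
  have h' := h.tendsto.mono_left ((D.nhdsGT_prod_nhds_le v₀).trans (nhdsWithin_le_of_mem hS))
  rwa [show D.ψ 0 (D.αplus 0) v₀ = v₀.proj from D.bdryPlus_zero v₀] at h'

theorem tendsto_bdryMinus (v₀ : TangentBundle 𝓘(ℝ, E) M) :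
    Tendsto (fun p : ℝ × TangentBundle 𝓘(ℝ, E) M => D.bdryMinus p.1 p.2) (𝓝[>] 0 ×ˢ 𝓝 v₀)
      (𝓝 v₀.proj) := by
  have hS := D.minusDomain_mem_nhdsWithin v₀
  have h := D.contMDiffOn_minus.continuousOn _
    (mem_of_mem_nhdsWithin (⟨D.zero_mem_Ico, mem_univ _⟩ : ((0 : ℝ), v₀) ∈ _ ×ˢ _) hS)
  have h' := h.tendsto.mono_left ((D.nhdsGT_prod_nhds_le v₀).trans (nhdsWithin_le_of_mem hS))
  rwa [show D.ψ 0 (D.αminus 0) v₀ = v₀.proj from D.bdryMinus_zero v₀] at h'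

/-- `∂⁺_h` in the charts at `v₀` and at its base point. -/
noncomputable def chartPlus (v₀ : TangentBundle 𝓘(ℝ, E) M) (p : ℝ × (E × E)) : E :=
  extChartAt 𝓘(ℝ, E) v₀.proj (D.bdryPlus p.1 ((extChartAt 𝓘(ℝ, E).tangent v₀).symm p.2))

/-- `∂⁻_h` in the charts at `v₀` and at its base point. -/
noncomputable def chartMinus (v₀ : TangentBundle 𝓘(ℝ, E) M) (p : ℝ × (E × E)) : E :=
  extChartAt 𝓘(ℝ, E) v₀.proj (D.bdryMinus p.1 ((extChartAt 𝓘(ℝ, E).tangent v₀).symm p.2))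

/-- The map `(∂⁺_h, (∂⁺_h - ∂⁻_h) / h)` in the charts at `v₀` and at its base point. -/
noncomputable def chartPair (v₀ : TangentBundle 𝓘(ℝ, E) M) : ℝ → E × E → E × E :=
  rescaledPair (D.chartPlus v₀) (D.chartMinus v₀)

/-- The estimates for the rescaled boundary maps that hold on the ball of radius `δ` about `v₀` in
the chart at `v₀`, for `0 < h < δ`. -/
structure ChartEstimate (v₀ : TangentBundle 𝓘(ℝ, E) M) (δ : ℝ) : Prop where
  pos : 0 < δ
  ball_subset : Metric.ball (extChartAt 𝓘(ℝ, E).tangent v₀ v₀) δ ⊆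
    (extChartAt 𝓘(ℝ, E).tangent v₀).target
  bdryPlus_mem : ∀ h ∈ Ioo 0 δ, ∀ z ∈ Metric.ball (extChartAt 𝓘(ℝ, E).tangent v₀ v₀) δ,
    D.bdryPlus h ((extChartAt 𝓘(ℝ, E).tangent v₀).symm z) ∈ (extChartAt 𝓘(ℝ, E) v₀.proj).source
  bdryMinus_mem : ∀ h ∈ Ioo 0 δ, ∀ z ∈ Metric.ball (extChartAt 𝓘(ℝ, E).tangent v₀ v₀) δ,
    D.bdryMinus h ((extChartAt 𝓘(ℝ, E).tangent v₀).symm z) ∈ (extChartAt 𝓘(ℝ, E) v₀.proj).source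
  approximates : ∀ h ∈ Ioo 0 δ, ApproximatesLinearOn (D.chartPair v₀ h)
    (ContinuousLinearEquiv.refl ℝ (E × E) : E × E →L[ℝ] E × E)
    (Metric.ball (extChartAt 𝓘(ℝ, E).tangent v₀ v₀) δ) (1 / 2)
  contDiffOn : ∀ h ∈ Ioo 0 δ, ContDiffOn ℝ k (D.chartPair v₀ h)
    (Metric.ball (extChartAt 𝓘(ℝ, E).tangent v₀ v₀) δ)
  tendsto : Tendsto (fun h => D.chartPair v₀ h (extChartAt 𝓘(ℝ, E).tangent v₀ v₀)) (𝓝[>] 0)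
    (𝓝 (extChartAt 𝓘(ℝ, E).tangent v₀ v₀))

/-- Here `2 ≤ k` does its work, through the Lipschitz remainder estimate for both boundary maps. -/
theorem exists_chartEstimate (hk : 2 ≤ k) (v₀ : TangentBundle 𝓘(ℝ, E) M) :
    ∃ δ, D.ChartEstimate v₀ δ := by
  have hk2 : (2 : WithTop ℕ∞) ≤ k := WithTop.coe_le_coe.2 hk
  obtain ⟨δ₁, h₁, h₁a, h₁t, h₁m, h₁C, h₁d⟩ := exists_ball_contDiffOn_chart D.a_pos v₀
    (D.plusDomain_mem_nhdsWithin v₀) D.contMDiffOn_plus D.velocity_plus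
  obtain ⟨δ₂, h₂, h₂a, h₂t, h₂m, h₂C, h₂d⟩ := exists_ball_contDiffOn_chart D.a_pos v₀
    (D.minusDomain_mem_nhdsWithin v₀) D.contMDiffOn_minus D.velocity_minus
  have hr : 0 < min δ₁ δ₂ := lt_min h₁ h₂
  have hb₁ := Metric.ball_subset_ball (x := extChartAt 𝓘(ℝ, E).tangent v₀ v₀)
    (min_le_left δ₁ δ₂)
  have hb₂ := Metric.ball_subset_ball (x := extChartAt 𝓘(ℝ, E).tangent v₀ v₀)
    (min_le_right δ₁ δ₂)
  have hI₁ : Ico 0 (min δ₁ δ₂) ⊆ Ico 0 δ₁ := Ico_subset_Ico_right (min_le_left _ _)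
  have hI₂ : Ico 0 (min δ₁ δ₂) ⊆ Ico 0 δ₂ := Ico_subset_Ico_right (min_le_right _ _)
  have hCp : ContDiffOn ℝ k (D.chartPlus v₀)
      (Ico 0 (min δ₁ δ₂) ×ˢ Metric.ball (extChartAt 𝓘(ℝ, E).tangent v₀ v₀) (min δ₁ δ₂)) :=
    h₁C.mono (prod_mono hI₁ hb₁)
  have hCm : ContDiffOn ℝ k (D.chartMinus v₀)
      (Ico 0 (min δ₁ δ₂) ×ˢ Metric.ball (extChartAt 𝓘(ℝ, E).tangent v₀ v₀) (min δ₁ δ₂)) :=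
    h₂C.mono (prod_mono hI₂ hb₂)
  have hIa : Ico 0 (min δ₁ δ₂) ⊆ Ico 0 D.a := hI₁.trans (Ico_subset_Ico_right h₁a)
  obtain ⟨⟨δ, hδ, -, hδr, happ⟩, htend⟩ := exists_approximatesLinearOn_rescaledPair hr hr
    D.derivWithin_αplus_sub_derivWithin_αminus (hCp.of_le hk2) (hCm.of_le hk2)
    (fun z hz => (h₁d z (hb₁ hz)).1) (fun z hz => (h₂d z (hb₂ hz)).1)
    (fun z hz => (h₁d z (hb₁ hz)).2.mono hIa) (fun z hz => (h₂d z (hb₂ hz)).2.mono hIa)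
  have hb := Metric.ball_subset_ball (x := extChartAt 𝓘(ℝ, E).tangent v₀ v₀) hδr
  have hI : ∀ h ∈ Ioo 0 δ, h ∈ Ico 0 (min δ₁ δ₂) := fun h hh => ⟨hh.1.le, hh.2.trans_le hδr⟩
  refine ⟨δ, hδ, (hb.trans hb₁).trans h₁t, fun h hh z hz => (h₁m h (hI₁ (hI h hh)) z (hb₁ (hb hz))).2,
    fun h hh z hz => (h₂m h (hI₂ (hI h hh)) z (hb₂ (hb hz))).2, happ, fun h hh => ?_, htend⟩
  have hslice : ContDiffOn ℝ k (fun z : E × E => (h, z))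
      (Metric.ball (extChartAt 𝓘(ℝ, E).tangent v₀ v₀) δ) :=
    contDiffOn_const.prodMk contDiffOn_id
  have hp := hCp.comp hslice fun z hz => ⟨hI h hh, hb hz⟩
  have hm := hCm.comp hslice fun z hz => ⟨hI h hh, hb hz⟩
  exact hp.prodMk (contDiffOn_const.smul (hp.sub hm))

end TangentBundleDiscretization

/-! ### Local injectivity, local invertibility and the diagonal for small `h`. -/

namespace TangentBundleDiscretization

variable {E : Type*} [NormedAddCommGroup E] [NormedSpace ℝ E]
  {M : Type*} [TopologicalSpace M] [ChartedSpace E M] [IsManifold 𝓘(ℝ, E) ∞ M] {k : ℕ∞}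
  {D : TangentBundleDiscretization E M k} {v₀ : TangentBundle 𝓘(ℝ, E) M} {δ : ℝ}

theorem eventually_mem_ball (v₀ : TangentBundle 𝓘(ℝ, E) M) (hδ : 0 < δ) :
    ∀ᶠ p : ℝ × TangentBundle 𝓘(ℝ, E) M in 𝓝[>] (0 : ℝ) ×ˢ 𝓝 v₀, p.1 ∈ Ioo 0 δ ∧
      p.2 ∈ (extChartAt 𝓘(ℝ, E).tangent v₀).source ∧
      extChartAt 𝓘(ℝ, E).tangent v₀ p.2 ∈
        Metric.ball (extChartAt 𝓘(ℝ, E).tangent v₀ v₀) δ := by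
  have h1 : (extChartAt 𝓘(ℝ, E).tangent v₀).source ∩ extChartAt 𝓘(ℝ, E).tangent v₀ ⁻¹'
      Metric.ball (extChartAt 𝓘(ℝ, E).tangent v₀ v₀) δ ∈ 𝓝 v₀ :=
    inter_mem (extChartAt_source_mem_nhds v₀)
      ((continuousAt_extChartAt v₀).preimage_mem_nhds (Metric.ball_mem_nhds _ hδ))
  filter_upwards [prod_mem_prod (Ioo_mem_nhdsGT hδ) h1] with p hp using hp

theorem ChartEstimate.norm_sub_le (hD : D.ChartEstimate v₀ δ) {h : ℝ} (hh : h ∈ Ioo 0 δ)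
    {z z' : E × E} (hz : z ∈ Metric.ball (extChartAt 𝓘(ℝ, E).tangent v₀ v₀) δ)
    (hz' : z' ∈ Metric.ball (extChartAt 𝓘(ℝ, E).tangent v₀ v₀) δ) :
    ‖D.chartPair v₀ h z - D.chartPair v₀ h z' - (z - z')‖ ≤ 1 / 2 * ‖z - z'‖ := by
  simpa using hD.approximates h hh z hz z' hz'

theorem ChartEstimate.injOn (hD : D.ChartEstimate v₀ δ) {h : ℝ} (hh : h ∈ Ioo 0 δ) :
    InjOn (D.chartPair v₀ h) (Metric.ball (extChartAt 𝓘(ℝ, E).tangent v₀ v₀) δ) := by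
  intro z hz z' hz' he
  have := hD.norm_sub_le hh hz hz'
  rw [he, sub_self, zero_sub, norm_neg] at this
  exact sub_eq_zero.1 (norm_le_zero_iff.1 (by linarith))

/-- The Lipschitz bound upgrades convergence at the centre of the ball to joint convergence in `(h,
v)`. The factor `3/2` is `1/2` for the remainder plus `1` for the identity. -/
theorem ChartEstimate.tendsto_prod (hD : D.ChartEstimate v₀ δ) :
    Tendsto (fun p : ℝ × TangentBundle 𝓘(ℝ, E) M =>
      D.chartPair v₀ p.1 (extChartAt 𝓘(ℝ, E).tangent v₀ p.2)) (𝓝[>] 0 ×ˢ 𝓝 v₀)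
      (𝓝 (extChartAt 𝓘(ℝ, E).tangent v₀ v₀)) := by
  set z₀ := extChartAt 𝓘(ℝ, E).tangent v₀ v₀
  have h1 : Tendsto (fun p : ℝ × TangentBundle 𝓘(ℝ, E) M =>
      D.chartPair v₀ p.1 z₀ - z₀) (𝓝[>] 0 ×ˢ 𝓝 v₀) (𝓝 0) := by
    have := hD.tendsto.sub_const z₀
    rw [sub_self] at this
    exact this.comp tendsto_fst
  have h2 : Tendsto (fun p : ℝ × TangentBundle 𝓘(ℝ, E) M =>
      extChartAt 𝓘(ℝ, E).tangent v₀ p.2 - z₀) (𝓝[>] 0 ×ˢ 𝓝 v₀) (𝓝 0) := by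
    have := (continuousAt_extChartAt (I := 𝓘(ℝ, E).tangent) v₀).tendsto.sub_const z₀
    rw [sub_self] at this
    exact this.comp tendsto_snd
  refine tendsto_iff_norm_sub_tendsto_zero.2 ?_
  refine squeeze_zero' (g := fun p => ‖D.chartPair v₀ p.1 z₀ - z₀‖ +
    3 / 2 * ‖extChartAt 𝓘(ℝ, E).tangent v₀ p.2 - z₀‖) (Eventually.of_forall fun p => norm_nonneg _)
    ?_ ?_
  · filter_upwards [eventually_mem_ball v₀ hD.pos] with p hp
    have h3 := hD.norm_sub_le hp.1 hp.2.2 (Metric.mem_ball_self hD.pos)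
    have h4 : D.chartPair v₀ p.1 (extChartAt 𝓘(ℝ, E).tangent v₀ p.2) - z₀ =
        (D.chartPair v₀ p.1 (extChartAt 𝓘(ℝ, E).tangent v₀ p.2) - D.chartPair v₀ p.1 z₀ -
          (extChartAt 𝓘(ℝ, E).tangent v₀ p.2 - z₀)) +
        (D.chartPair v₀ p.1 z₀ - z₀) + (extChartAt 𝓘(ℝ, E).tangent v₀ p.2 - z₀) := by abel
    rw [h4]
    refine (norm_add₃_le).trans ?_
    linarith
  · simpa using h1.norm.add (h2.norm.const_mul (3 / 2))

theorem chartPair_congr {h : ℝ} {v w : TangentBundle 𝓘(ℝ, E) M}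
    (hv : v ∈ (extChartAt 𝓘(ℝ, E).tangent v₀).source)
    (hw : w ∈ (extChartAt 𝓘(ℝ, E).tangent v₀).source)
    (hp : D.bdryPlus h v = D.bdryPlus h w) (hm : D.bdryMinus h v = D.bdryMinus h w) :
    D.chartPair v₀ h (extChartAt 𝓘(ℝ, E).tangent v₀ v) =
      D.chartPair v₀ h (extChartAt 𝓘(ℝ, E).tangent v₀ w) := by
  simp only [chartPair, rescaledPair, chartPlus, chartMinus, PartialEquiv.left_inv _ hv,
    PartialEquiv.left_inv _ hw, hp, hm]

/-- Charts of `TM` come from charts of the base, so vectors in one fibre share a chart and their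
rescaled pairs can be compared. -/
theorem extChartAt_tangent_congr {v w : TangentBundle 𝓘(ℝ, E) M} (h : v.proj = w.proj) :
    extChartAt 𝓘(ℝ, E).tangent v = extChartAt 𝓘(ℝ, E).tangent w := by
  obtain ⟨m, u⟩ := v
  obtain ⟨m', u'⟩ := w
  obtain rfl : m = m' := h
  rfl

/-- The boundary maps are jointly injective near each pair of tangent vectors, for small `h > 0`. -/
theorem eventually_injective [T2Space M] (hk : 2 ≤ k) (D : TangentBundleDiscretization E M k)
    (v₀ w₀ : TangentBundle 𝓘(ℝ, E) M) :
    ∀ᶠ p : ℝ × TangentBundle 𝓘(ℝ, E) M × TangentBundle 𝓘(ℝ, E) M in 𝓝[>] (0 : ℝ) ×ˢ 𝓝 (v₀, w₀),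
      D.bdryPlus p.1 p.2.1 = D.bdryPlus p.1 p.2.2 →
      D.bdryMinus p.1 p.2.1 = D.bdryMinus p.1 p.2.2 → p.2.1 = p.2.2 := by
  have t₁ : Tendsto (fun p : ℝ × TangentBundle 𝓘(ℝ, E) M × TangentBundle 𝓘(ℝ, E) M =>
      (p.1, p.2.1)) (𝓝[>] (0 : ℝ) ×ˢ 𝓝 (v₀, w₀)) (𝓝[>] (0 : ℝ) ×ˢ 𝓝 v₀) :=
    tendsto_fst.prodMk ((continuous_fst.tendsto (v₀, w₀)).comp tendsto_snd)
  have t₂ : Tendsto (fun p : ℝ × TangentBundle 𝓘(ℝ, E) M × TangentBundle 𝓘(ℝ, E) M =>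
      (p.1, p.2.2)) (𝓝[>] (0 : ℝ) ×ˢ 𝓝 (v₀, w₀)) (𝓝[>] (0 : ℝ) ×ˢ 𝓝 w₀) :=
    tendsto_fst.prodMk ((continuous_snd.tendsto (v₀, w₀)).comp tendsto_snd)
  by_cases hb : v₀.proj = w₀.proj
  · obtain ⟨δ, hδ⟩ := D.exists_chartEstimate hk v₀
    by_cases hvw : v₀ = w₀
    -- Near a single vector, injectivity of the rescaled pair on the ball suffices.
    · subst hvw
      filter_upwards [t₁.eventually (eventually_mem_ball v₀ hδ.pos),
        t₂.eventually (eventually_mem_ball v₀ hδ.pos)] with p h₁ h₂ hp hm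
      exact (extChartAt 𝓘(ℝ, E).tangent v₀).injOn h₁.2.1 h₂.2.1
        (hδ.injOn h₁.1 h₁.2.2 h₂.2.2 (chartPair_congr h₁.2.1 h₂.2.1 hp hm))
    -- Distinct vectors in one fibre need not lie in a common ball, but their rescaled pairs, taken
    -- in the shared chart, have distinct limits.
    · obtain ⟨δ', hδ'⟩ := D.exists_chartEstimate hk w₀
      have hpair : D.chartPair w₀ = D.chartPair v₀ := by
        unfold chartPair chartPlus chartMinus
        rw [extChartAt_tangent_congr hb, hb]
      have s₁ := hδ.tendsto_prod.comp t₁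
      have s₂ := hδ'.tendsto_prod.comp t₂
      rw [hpair] at s₂
      rw [← extChartAt_tangent_congr hb] at s₂
      have hne : extChartAt 𝓘(ℝ, E).tangent v₀ v₀ ≠ extChartAt 𝓘(ℝ, E).tangent v₀ w₀ := fun he =>
        hvw ((extChartAt 𝓘(ℝ, E).tangent v₀).injOn (mem_extChartAt_source v₀)
          (by rw [extChartAt_tangent_congr hb]; exact mem_extChartAt_source w₀) he)
      filter_upwards [t₁.eventually (eventually_mem_ball v₀ hδ.pos),
        t₂.eventually (eventually_mem_ball w₀ hδ'.pos), 
        (s₁.prodMk_nhds s₂).eventually (isClosed_diagonal.isOpen_compl.mem_nhds hne)]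
        with p h₁ h₂ h₃ hp hm
      rw [← extChartAt_tangent_congr hb] at h₂
      exact absurd (chartPair_congr h₁.2.1 h₂.2.1 hp hm) h₃
  -- Over distinct base points the values of `∂⁺_h` already separate, as `M` is Hausdorff.
  · filter_upwards [(((D.tendsto_bdryPlus v₀).comp t₁).prodMk_nhds
      ((D.tendsto_bdryPlus w₀).comp t₂)).eventually (isClosed_diagonal.isOpen_compl.mem_nhds hb)] with p h hp
    exact absurd hp h

/-- The linear automorphism `(x, y) ↦ (x, x - h • y)`. -/
noncomputable def unscale (E : Type*) [NormedAddCommGroup E] [NormedSpace ℝ E] (h : ℝ)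
    (hh : h ≠ 0) : (E × E) ≃L[ℝ] (E × E) :=
  ContinuousLinearEquiv.equivOfInverse
    ((ContinuousLinearMap.fst ℝ E E).prod
      (ContinuousLinearMap.fst ℝ E E - h • ContinuousLinearMap.snd ℝ E E))
    ((ContinuousLinearMap.fst ℝ E E).prod
      (h⁻¹ • (ContinuousLinearMap.fst ℝ E E - ContinuousLinearMap.snd ℝ E E)))
    (fun z => by ext <;> simp [hh]) (fun z => by ext <;> simp [hh])

theorem unscale_chartPair {h : ℝ} (hh : h ≠ 0) (z : E × E) :
    unscale E h hh (D.chartPair v₀ h z) = (D.chartPlus v₀ (h, z), D.chartMinus v₀ (h, z)) := by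
  ext <;> simp [unscale, chartPair, rescaledPair, hh]

/-- Near `v` the map factors as the tangent chart, the rescaled pair, `unscale`, and an inverse
product chart, all local diffeomorphisms. -/
theorem eventually_isLocalDiffeomorphAt [CompleteSpace E] (hk : 2 ≤ k)
    (D : TangentBundleDiscretization E M k) (v₀ : TangentBundle 𝓘(ℝ, E) M) :
    ∀ᶠ p : ℝ × TangentBundle 𝓘(ℝ, E) M in 𝓝[>] (0 : ℝ) ×ˢ 𝓝 v₀,
      IsLocalDiffeomorphAt 𝓘(ℝ, E).tangent (𝓘(ℝ, E).prod 𝓘(ℝ, E)) k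
        (fun v => (D.bdryPlus p.1 v, D.bdryMinus p.1 v)) p.2 := by
  obtain ⟨δ, hδ⟩ := D.exists_chartEstimate hk v₀
  filter_upwards [eventually_mem_ball v₀ hδ.pos] with p hp
  obtain ⟨h, v⟩ := p
  obtain ⟨hh, hvs, hvb⟩ := hp
  have hkTop : (k : WithTop ℕ∞) ≤ ∞ := by exact_mod_cast le_top
  have hk0 : (k : WithTop ℕ∞) ≠ 0 := by
    have : k ≠ 0 := by rintro rfl; simp at hk
    exact_mod_cast this
  have : IsManifold 𝓘(ℝ, E) k M := .of_le hkTop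
  have : IsManifold 𝓘(ℝ, E).tangent k (TangentBundle 𝓘(ℝ, E) M) := .of_le hkTop
  set e := extChartAt 𝓘(ℝ, E).tangent v₀
  let j := extChartAt (𝓘(ℝ, E).prod 𝓘(ℝ, E)) (v₀.proj, v₀.proj)
  have h1 : IsLocalDiffeomorphAt 𝓘(ℝ, E).tangent 𝓘(ℝ, E × E) k e v :=
    isLocalDiffeomorphAt_extChartAt hvs
  have h2 : IsLocalDiffeomorphAt 𝓘(ℝ, E × E) 𝓘(ℝ, E × E) k (D.chartPair v₀ h) (e v) :=
    (hδ.approximates h hh).isLocalDiffeomorphAt Metric.isOpen_ball hk0 (hδ.contDiffOn h hh) hvb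
  have h3 : IsLocalDiffeomorphAt 𝓘(ℝ, E × E) 𝓘(ℝ, E × E) k (unscale E h hh.1.ne')
      (D.chartPair v₀ h (e v)) :=
    ((unscale E h hh.1.ne').toDiffeomorph.isLocalDiffeomorph _).of_le hkTop
  have hj : ∀ w, e w ∈ Metric.ball (e v₀) δ → w ∈ e.source →
      (D.bdryPlus h w, D.bdryMinus h w) ∈ j.source ∧
      unscale E h hh.1.ne' (D.chartPair v₀ h (e w)) = j (D.bdryPlus h w, D.bdryMinus h w) := by
    intro w hw hws
    have hp := hδ.bdryPlus_mem h hh _ hw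
    have hm := hδ.bdryMinus_mem h hh _ hw
    rw [e.left_inv hws] at hp hm
    rw [unscale_chartPair, chartPlus, chartMinus]
    simp only [j, extChartAt_prod]
    refine ⟨⟨hp, hm⟩, ?_⟩
    change (extChartAt 𝓘(ℝ, E) v₀.proj (D.bdryPlus h (e.symm (e w))),
      extChartAt 𝓘(ℝ, E) v₀.proj (D.bdryMinus h (e.symm (e w)))) = _
    rw [e.left_inv hws]
    rfl
  have h4 : IsLocalDiffeomorphAt 𝓘(ℝ, E × E) (𝓘(ℝ, E).prod 𝓘(ℝ, E)) k j.symm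
      (unscale E h hh.1.ne' (D.chartPair v₀ h (e v))) := by
    refine isLocalDiffeomorphAt_extChartAt_symm ?_
    rw [(hj v hvb hvs).2]
    exact j.map_source (hj v hvb hvs).1
  have h5 := ((h1.comp (hg := h2)).comp (hg := h3)).comp (hg := h4)
  refine h5.congr_of_eventuallyEq ?_
  filter_upwards [(isOpen_extChartAt_source v₀).mem_nhds hvs,
    (h1.contMDiffAt.continuousAt).preimage_mem_nhds (Metric.isOpen_ball.mem_nhds hvb)] with w hws hwb
  simp only [Function.comp_apply]
  rw [(hj w hwb hws).2, j.left_inv (hj w hwb hws).1]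

/-- For small `h > 0` the point `(m, m)` of the diagonal is the value of `(∂⁺_h, ∂⁻_h)` at a small
tangent vector. -/
theorem eventually_exists_diagonal [CompleteSpace E] (hk : 2 ≤ k)
    (D : TangentBundleDiscretization E M k) (m₀ : M) {N : Set (TangentBundle 𝓘(ℝ, E) M)}
    (hN : N ∈ 𝓝 (⟨m₀, 0⟩ : TangentBundle 𝓘(ℝ, E) M)) :
    ∀ᶠ p : ℝ × M in 𝓝[>] (0 : ℝ) ×ˢ 𝓝 m₀,
      ∃ v ∈ N, D.bdryPlus p.1 v = p.2 ∧ D.bdryMinus p.1 v = p.2 := by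
  set v₀ : TangentBundle 𝓘(ℝ, E) M := ⟨m₀, 0⟩ with hv₀
  obtain ⟨δ, hδ⟩ := D.exists_chartEstimate hk v₀
  set e := extChartAt 𝓘(ℝ, E).tangent v₀ with he
  set φ := extChartAt 𝓘(ℝ, E) m₀ with hφ
  have : IsManifold 𝓘(ℝ, E) 1 M := .of_le (n := ∞) (by exact_mod_cast le_top)
  have hev₀ : e v₀ = (φ m₀, 0) := by
    refine Prod.ext rfl ?_
    rw [he, extChartAt_tangent_snd (mem_extChartAt_source v₀.proj)]
    exact map_zero _
  have hN' : e.symm ⁻¹' N ∈ 𝓝 (e v₀) := by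
    refine (continuousAt_extChartAt_symm v₀).preimage_mem_nhds ?_
    rw [extChartAt_to_inv]
    exact hN
  obtain ⟨r, hr, hrsub⟩ := Metric.nhds_basis_closedBall.mem_iff.1
    (inter_mem hN' (Metric.ball_mem_nhds (e v₀) hδ.pos))
  -- With a right inverse of norm `1` and Lipschitz error `1/2`, the image of a closed ball of
  -- radius `r` contains one of radius `(1 - 1/2) r`; hence the bound in `hclose`.
  let R : ((ContinuousLinearEquiv.refl ℝ (E × E) : E × E →L[ℝ] E × E)).NonlinearRightInverse :=
    { toFun := id
      nnnorm := 1
      bound' := fun y => by simp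
      right_inv' := fun y => rfl }
  have hclose : ∀ᶠ p : ℝ × M in 𝓝[>] (0 : ℝ) ×ˢ 𝓝 m₀,
      dist ((φ p.2, (0 : E)) : E × E) (D.chartPair v₀ p.1 (e v₀)) < 1 / 2 * r := by
    have t1 : Tendsto (fun p : ℝ × M => ((φ p.2, (0 : E)) : E × E)) (𝓝[>] (0 : ℝ) ×ˢ 𝓝 m₀)
        (𝓝 (e v₀)) := by
      rw [hev₀]
      exact ((continuousAt_extChartAt (I := 𝓘(ℝ, E)) m₀).tendsto.comp tendsto_snd).prodMk_nhds
        tendsto_const_nhds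
    have t2 := t1.dist (hδ.tendsto.comp tendsto_fst)
    rw [dist_self] at t2
    exact t2.eventually_lt_const (by positivity)
  filter_upwards [hclose, prod_mem_prod (Ioo_mem_nhdsGT hδ.pos)
    (extChartAt_source_mem_nhds (I := 𝓘(ℝ, E)) m₀)] with p hp hps
  obtain ⟨h, m⟩ := p
  obtain ⟨hh, hm⟩ := hps
  have hsurj := (hδ.approximates h hh).surjOn_closedBall_of_nonlinearRightInverse R hr.le
    (hrsub.trans inter_subset_right)
  obtain ⟨z, hz, hzG⟩ := @hsurj (φ m, 0) (by
    rw [Metric.mem_closedBall]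
    refine hp.le.trans (le_of_eq ?_)
    norm_num [R])
  -- A vanishing difference quotient means that both boundary maps take the same value.
  rw [chartPair, rescaledPair_eq_iff hh.1.ne', smul_zero, sub_zero] at hzG
  have hzb := (hrsub hz).2
  exact ⟨e.symm z, (hrsub hz).1, φ.injOn (hδ.bdryPlus_mem h hh z hzb) hm hzG.1,
    φ.injOn (hδ.bdryMinus_mem h hh z hzb) hm hzG.2⟩

end TangentBundleDiscretization

/-! ### Separation and countability of the tangent bundle. -/

section TangentBundleTopology

variable {E : Type*} [NormedAddCommGroup E] [NormedSpace ℝ E]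
  {M : Type*} [TopologicalSpace M] [ChartedSpace E M] [IsManifold 𝓘(ℝ, E) ∞ M]

theorem t2Space_tangentBundle [T2Space M] : T2Space (TangentBundle 𝓘(ℝ, E) M) := by
  refine ⟨fun v w hvw => ?_⟩
  by_cases hb : v.proj = w.proj
  · have hcont := continuousOn_extChartAt (I := 𝓘(ℝ, E).tangent) v
    have hopen := isOpen_extChartAt_source (I := 𝓘(ℝ, E).tangent) v
    have hv := mem_extChartAt_source (I := 𝓘(ℝ, E).tangent) v
    have hw : w ∈ (extChartAt 𝓘(ℝ, E).tangent v).source := by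
      rw [mem_extChartAt_tangent_source, ← hb]
      exact mem_extChartAt_source v.proj
    obtain ⟨s, t, hs, ht, hvs, hwt, hst⟩ :=
      t2_separation ((extChartAt 𝓘(ℝ, E).tangent v).injOn.ne hv hw hvw)
    exact ⟨_, _, hcont.isOpen_inter_preimage hopen hs, hcont.isOpen_inter_preimage hopen ht,
      ⟨hv, hvs⟩, ⟨hw, hwt⟩, (hst.preimage _).mono inter_subset_right inter_subset_right⟩
  · exact separated_by_continuous (FiberBundle.continuous_proj E (TangentSpace 𝓘(ℝ, E))) hb

theorem secondCountableTopology_tangentBundle [FiniteDimensional ℝ E]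
    [SecondCountableTopology M] : SecondCountableTopology (TangentBundle 𝓘(ℝ, E) M) := by
  have : SecondCountableTopology (ModelProd E E) :=
    inferInstanceAs (SecondCountableTopology (E × E))
  obtain ⟨s, hs, hcov⟩ := TopologicalSpace.countable_cover_nhds fun m : M => chart_source_mem_nhds E m
  refine ChartedSpace.secondCountable_of_countable_cover (ModelProd E E)
    (s := (fun m : M => (⟨m, 0⟩ : TangentBundle 𝓘(ℝ, E) M)) '' s) ?_ (hs.image _)
  refine eq_univ_of_forall fun v => ?_
  obtain ⟨m, hm, hv⟩ := mem_iUnion₂.1 (hcov.symm ▸ mem_univ v.proj : v.proj ∈ ⋃ x ∈ s, _)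
  exact mem_iUnion₂.2 ⟨_, mem_image_of_mem _ hm, (TangentBundle.mem_chart_source_iff v _).2 hv⟩

end TangentBundleTopology

/-- A tube lemma: it turns the local results into statements uniform over a compact set. -/
theorem IsCompact.eventually_forall_mem {X Y : Type*} [TopologicalSpace Y] {l : Filter X}
    {K : Set Y} (hK : IsCompact K) {P : X → Y → Prop}
    (h : ∀ y ∈ K, ∀ᶠ p : X × Y in l ×ˢ 𝓝 y, P p.1 p.2) : ∀ᶠ x in l, ∀ y ∈ K, P x y := by
  have h1 : {p : X × Y | P p.1 p.2} ∈ l ×ˢ 𝓝ˢ K := hK.mem_prod_nhdsSet_of_forall h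
  filter_upwards [Eventually.curry h1] with x hx using hx.self_of_nhdsSet

/-! ### Uniformity on compact sets and construction of the discrete tangent bundles. -/

section Construction

variable {E : Type*} [NormedAddCommGroup E] [NormedSpace ℝ E] [FiniteDimensional ℝ E]
  {M : Type*} [TopologicalSpace M] [T2Space M]
  [ChartedSpace E M] [IsManifold 𝓘(ℝ, E) ∞ M] {k : ℕ∞}

/-- On the set `K` the boundary maps at the time `h` are defined, and they form an injective local
diffeomorphism to `M × M`. -/
structure TangentBundleDiscretization.IsGoodOn (D : TangentBundleDiscretization E M k) (h : ℝ)
    (K : Set (TangentBundle 𝓘(ℝ, E) M)) : Prop where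
  subset_bdryDomain : K ⊆ D.bdryDomain h
  isLocalDiffeomorphAt : ∀ v ∈ K,
    IsLocalDiffeomorphAt 𝓘(ℝ, E).tangent (𝓘(ℝ, E).prod 𝓘(ℝ, E)) k
      (fun v => (D.bdryPlus h v, D.bdryMinus h v)) v
  injOn : InjOn (fun v => (D.bdryPlus h v, D.bdryMinus h v)) K

/-- Injectivity is a condition on pairs, so compactness is applied to `K ×ˢ K` for it. -/
theorem TangentBundleDiscretization.eventually_isGoodOn (hk : 2 ≤ k)
    (D : TangentBundleDiscretization E M k) {K : Set (TangentBundle 𝓘(ℝ, E) M)}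
    (hK : IsCompact K) : ∀ᶠ h in 𝓝[>] (0 : ℝ), D.IsGoodOn h K := by
  have : CompleteSpace E := FiniteDimensional.complete ℝ E
  filter_upwards [hK.eventually_forall_mem (P := fun h v => v ∈ D.bdryDomain h)
      fun v _ => D.eventually_mem_bdryDomain v,
    hK.eventually_forall_mem (P := fun h v =>
      IsLocalDiffeomorphAt 𝓘(ℝ, E).tangent (𝓘(ℝ, E).prod 𝓘(ℝ, E)) k
        (fun v => (D.bdryPlus h v, D.bdryMinus h v)) v) fun v _ => eventually_isLocalDiffeomorphAt hk D v,
    (hK.prod hK).eventually_forall_mem (P := fun h q => D.bdryPlus h q.1 = D.bdryPlus h q.2 →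
      D.bdryMinus h q.1 = D.bdryMinus h q.2 → q.1 = q.2)
      fun q _ => eventually_injective hk D q.1 q.2] with h h1 h2 h3
  exact ⟨h1, h2, fun v hv w hw hvw =>
    h3 (v, w) ⟨hv, hw⟩ (congrArg Prod.fst hvw) (congrArg Prod.snd hvw)⟩

/-- A set on which the boundary maps form an injective local diffeomorphism with values in `M₀`,
and which meets each diagonal fibre, is a discrete tangent bundle of `M₀`. -/
theorem TangentBundleDiscretization.IsGoodOn.exists_isDiscreteTangentBundle
    [SecondCountableTopology M] (hk : k ≠ 0)
    {D : TangentBundleDiscretization E M k} {h : ℝ} {V : Opens (TangentBundle 𝓘(ℝ, E) M)}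
    (hV : D.IsGoodOn h V) {M₀ : Opens M}
    (hmem : ∀ v ∈ V, D.bdryPlus h v ∈ M₀ ∧ D.bdryMinus h v ∈ M₀)
    (hdiag : ∀ m ∈ M₀, ∃ v ∈ V, D.bdryPlus h v = m ∧ D.bdryMinus h v = m) :
    ∃ dplus dminus : V → M₀,
      (∀ v : V, (dplus v : M) = D.bdryPlus h v ∧ (dminus v : M) = D.bdryMinus h v) ∧
      IsDiscreteTangentBundle 𝓘(ℝ, E).tangent 𝓘(ℝ, E) k dplus dminus ∧
      ∃ W : Opens (M₀ × M₀), (∀ m : M₀, (m, m) ∈ W) ∧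
        ∃ Φ : Diffeomorph 𝓘(ℝ, E).tangent (𝓘(ℝ, E).prod 𝓘(ℝ, E)) V W k,
          ∀ v : V, (Φ v : M₀ × M₀) = (dplus v, dminus v) := by
  let dplus : V → M₀ := fun v => ⟨D.bdryPlus h v, (hmem v v.2).1⟩
  let dminus : V → M₀ := fun v => ⟨D.bdryMinus h v, (hmem v v.2).2⟩
  have hinj : Function.Injective fun v => (dplus v, dminus v) := fun v w hvw =>
    Subtype.ext (hV.injOn v.2 w.2 (congrArg (Prod.map Subtype.val Subtype.val) hvw))
  have hcomp : ∀ v : V, IsLocalDiffeomorphAt 𝓘(ℝ, E).tangent (𝓘(ℝ, E).prod 𝓘(ℝ, E)) k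
      (Prod.map Subtype.val Subtype.val ∘ fun v : V => (dplus v, dminus v)) v := fun v =>
    IsLocalDiffeomorphAt.comp (hf := isLocalDiffeomorph_subtype_val V v)
      (hg := hV.isLocalDiffeomorphAt v v.2)
  -- The inclusion of `M₀ × M₀` in `M × M` is a local diffeomorphism and an embedding, so it can be
  -- cancelled from `hcomp`.
  have hloc : IsLocalDiffeomorph 𝓘(ℝ, E).tangent (𝓘(ℝ, E).prod 𝓘(ℝ, E)) k
      fun v => (dplus v, dminus v) := fun v =>
    IsLocalDiffeomorphAt.of_comp_left
      ((isLocalDiffeomorph_subtype_val M₀ (dplus v)).prodMap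
        (isLocalDiffeomorph_subtype_val M₀ (dminus v)))
      ((IsEmbedding.subtypeVal.prodMap IsEmbedding.subtypeVal).isInducing.continuousAt_iff.2
        (hcomp v).contMDiffAt.continuousAt) (hcomp v)
  have hdiag' : ∀ m : M₀, ∃ v, dplus v = m ∧ dminus v = m := fun m => by
    obtain ⟨v, hv, hp, hm⟩ := hdiag m m.2
    exact ⟨⟨v, hv⟩, Subtype.ext hp, Subtype.ext hm⟩
  have := t2Space_tangentBundle (E := E) (M := M)
  have := secondCountableTopology_tangentBundle (E := E) (M := M)
  obtain ⟨Φ, hΦ⟩ := hloc.exists_diffeomorph_range hinj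
  refine ⟨dplus, dminus, fun v => ⟨rfl, rfl⟩,
    isDiscreteTangentBundle_of_isLocalDiffeomorph hk hloc hinj hdiag', hloc.image, fun m => ?_,
    Φ, hΦ⟩
  obtain ⟨v, hp, hm⟩ := hdiag' m
  exact ⟨v, Prod.ext hp hm⟩

end Construction

theorem mainTheorem1
    {E : Type*} [NormedAddCommGroup E] [NormedSpace ℝ E] [FiniteDimensional ℝ E]
    {M : Type*} [TopologicalSpace M] [T2Space M] [SecondCountableTopology M]
    [ChartedSpace E M] [IsManifold 𝓘(ℝ, E) ∞ M]
    {k : ℕ∞} (hk : 2 ≤ k) (D : TangentBundleDiscretization E M k)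
    (M₀ : Opens M) (hM₀ : IsCompact (closure (M₀ : Set M))) :
    ∃ a : ℝ, 0 < a ∧ ∃ V : ℝ → Opens (TangentBundle 𝓘(ℝ, E) M),
      (∀ h ∈ Ioo 0 a,
        (V h : Set (TangentBundle 𝓘(ℝ, E) M)) ⊆ D.bdryDomain h ∧
        ∃ dplus dminus : V h → M₀,
          (∀ v : V h, (dplus v : M) = D.bdryPlus h v ∧ (dminus v : M) = D.bdryMinus h v) ∧
          IsDiscreteTangentBundle 𝓘(ℝ, E).tangent 𝓘(ℝ, E) k dplus dminus ∧
          ∃ W : Opens (M₀ × M₀), (∀ m : M₀, (m, m) ∈ W) ∧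
            ∃ Φ : Diffeomorph 𝓘(ℝ, E).tangent (𝓘(ℝ, E).prod 𝓘(ℝ, E)) (V h) W k,
              ∀ v : V h, (Φ v : M₀ × M₀) = (dplus v, dminus v)) ∧
      ∀ v : TangentBundle 𝓘(ℝ, E) M, v.proj ∈ M₀ → ∀ᶠ h in 𝓝[>] (0 : ℝ), v ∈ V h := by
  have : CompleteSpace E := FiniteDimensional.complete ℝ E
  have := t2Space_tangentBundle (E := E) (M := M)
  have := secondCountableTopology_tangentBundle (E := E) (M := M)
  have : LocallyCompactSpace (TangentBundle 𝓘(ℝ, E) M) :=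
    Manifold.locallyCompact_of_finiteDimensional 𝓘(ℝ, E).tangent
  have hk0 : k ≠ 0 := by rintro rfl; simp at hk
  let K : CompactExhaustion (TangentBundle 𝓘(ℝ, E) M) := default
  -- Admitting every good `n` avoids choosing an index as a function of `h`. Injectivity survives
  -- the union because the exhaustion is nested: two vectors lie in the larger of their two good
  -- sets.
  let V₀ : ℝ → Set (TangentBundle 𝓘(ℝ, E) M) := fun h =>
    {v | (∃ n, D.IsGoodOn h (K n) ∧ v ∈ interior (K n)) ∧
      D.bdryPlus h v ∈ M₀ ∧ D.bdryMinus h v ∈ M₀}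
  have hgood : ∀ h, D.IsGoodOn h (V₀ h) := fun h =>
    { subset_bdryDomain := fun v ⟨⟨n, hn, hv⟩, _⟩ => hn.subset_bdryDomain (interior_subset hv)
      isLocalDiffeomorphAt := fun v ⟨⟨n, hn, hv⟩, _⟩ =>
        hn.isLocalDiffeomorphAt v (interior_subset hv)
      injOn := by
        rintro v ⟨⟨n, hn, hv⟩, -⟩ w ⟨⟨n', hn', hw⟩, -⟩ hvw
        rcases le_total n n' with hle | hle
        · exact hn'.injOn (K.subset hle (interior_subset hv)) (interior_subset hw) hvw
        · exact hn.injOn (interior_subset hv) (K.subset hle (interior_subset hw)) hvw }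
  have hopen : ∀ h, IsOpen (V₀ h) := fun h => by
    refine isOpen_iff_mem_nhds.2 fun v hv => ?_
    obtain ⟨⟨n, hn, hvn⟩, hp, hm⟩ := hv
    have hc := (hn.isLocalDiffeomorphAt v (interior_subset hvn)).contMDiffAt.continuousAt
    filter_upwards [isOpen_interior.mem_nhds hvn,
      hc.preimage_mem_nhds ((M₀.isOpen.prod M₀.isOpen).mem_nhds ⟨hp, hm⟩)] with w hw hw'
      using ⟨⟨n, hn, hw⟩, hw'⟩
  have hzero : IsCompact ((fun m : M => (⟨m, 0⟩ : TangentBundle 𝓘(ℝ, E) M)) ''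
      closure (M₀ : Set M)) :=
    hM₀.image (Bundle.contMDiff_zeroSection ℝ (TangentSpace 𝓘(ℝ, E) : M → Type _)
      (IB := 𝓘(ℝ, E)) (n := ∞)).continuous
  -- Diagonal points are attained near the zero section, which over the closure of `M₀` is compact.
  -- Passing to `N + 1` puts it in an interior.
  obtain ⟨N, hN⟩ := K.exists_superset_of_isCompact hzero
  have hN' : ∀ m ∈ closure (M₀ : Set M),
      interior (K (N + 1)) ∈ 𝓝 (⟨m, 0⟩ : TangentBundle 𝓘(ℝ, E) M) := fun m hm =>
    isOpen_interior.mem_nhds (K.subset_interior_succ N (hN (mem_image_of_mem _ hm)))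
  -- `V₀ h` is open and good for every `h`; the bound `a` is needed only to reach the whole
  -- diagonal.
  obtain ⟨a, ha, hIoo⟩ := mem_nhdsGT_iff_exists_Ioo_subset.1
    ((D.eventually_isGoodOn hk (K.isCompact (N + 1))).and
      (hM₀.eventually_forall_mem (P := fun h m => ∃ v ∈ interior (K (N + 1)),
        D.bdryPlus h v = m ∧ D.bdryMinus h v = m)
        fun m hm => TangentBundleDiscretization.eventually_exists_diagonal hk D m (hN' m hm)))
  refine ⟨a, ha, fun h => ⟨V₀ h, hopen h⟩, fun h hh => ⟨(hgood h).subset_bdryDomain, ?_⟩, ?_⟩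
  · refine (hgood h).exists_isDiscreteTangentBundle (V := ⟨V₀ h, hopen h⟩) hk0
      (fun v hv => hv.2) fun m hm => ?_
    obtain ⟨v, hv, hp, hm'⟩ := (hIoo hh).2 m (subset_closure hm)
    exact ⟨v, ⟨⟨N + 1, (hIoo hh).1, hv⟩, hp.symm ▸ hm, hm'.symm ▸ hm⟩, hp, hm'⟩
  · intro v hv
    obtain ⟨n, hn⟩ := K.exists_mem v
    have hM₀v := M₀.isOpen.mem_nhds hv
    have ht : Tendsto (fun h : ℝ => (h, v)) (𝓝[>] 0) (𝓝[>] 0 ×ˢ 𝓝 v) :=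
      tendsto_id.prodMk tendsto_const_nhds
    filter_upwards [D.eventually_isGoodOn hk (K.isCompact (n + 1)),
      ((D.tendsto_bdryPlus v).comp ht) hM₀v, ((D.tendsto_bdryMinus v).comp ht) hM₀v]
      with h h1 h2 h3 using ⟨⟨n + 1, h1, K.subset_interior_succ n hn⟩, h2, h3⟩
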